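/- \textbf{Theorem (surface transport theorem).} Let $J\subset\mathbb R$ be an open interval and let $\{\Sigma(t)\}_{t\in J}$ be a $\mathcal C^{1,2}$-family of moving closed hypersurfaces in $\mathbb R^n$, i.e. each $\Sigma(t)\subset\mathbb R^n$ is a closed set and: (i) the graph $\mathcal M=\{(t,x): t\in J,\ x\in\Sigma(t)\}$ is a $C^1$-hypersurface (without boundary) in $\mathbb R\times\mathbb R^n$ with a continuous unit normal field $n_{\mathcal M}=(n^t_{\mathcal M},n^x_{\mathcal M})$ such that $n^x_{\mathcal M}\neq 0$ on $\mathcal M$; (ii) each $\Sigma(t)$ is a $C^2$-hypersurface (without boundary) in $\mathbb R^n$, with unit normal $n_\Sigma=n^x_{\mathcal M}/\|n^x_{\mathcal M}\|$; (iii) $n_\Sigma\in C^1(\mathcal M)$. Let $V_\Sigma=-\,n^t_{\mathcal M}/\|n^x_{\mathcal M}\|$ be the speed of normal displacement, and let $v^\Sigma\in C^1(\mathcal M;\mathbb R^n)$ be a consistent velocity field, i.e. $v^\Sigma\cdot n_\Sigma=V_\Sigma$ on $\mathcal M$. Let $\{A(t)\}_{t\in J}$ be a family of co-moving areas with $C^1$-boundary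 inside $\Sigma(\cdot)$. This means that there is $t_0\in J$ such that $A(t_0)\subseteq\Sigma(t_0)$ is a compact $(n-1)$-dimensional $C^1$-submanifold with (possibly empty) boundary of $\Sigma(t_0)$, that for every $x_0\in A(t_0)$ the initial value problem $\dot x(t)=v^\Sigma(t,x(t))$, $x(t)\in\Sigma(t)$, $x(t_0)=x_0$, has a solution on all of $J$, and that for every $t\in J$ the set $A(t)$ consists of the values $x(t)$ at time $t$ of all these solutions with $x_0\in A(t_0)$. Let $\phi^\Sigma:\mathcal M\to\mathbb R$ be a $C^1$-function. Then for every $t\in J$ the functions $\phi^\Sigma(t,\cdot)$ and $\frac{D^\Sigma}{Dt}\phi^\Sigma(t,\cdot)+\phi^\Sigma(t,\cdot)\,\mathrm{div}_\Sigma v^\Sigma(t,\cdot)$ are integrable over $A(t)$ with respect to the $(n-1)$-dimensional surface measure $do$, the function $s\mapsto\int_{A(s)}\phi^\Sigma(s,\cdot)\,do$ is differentiable at $t$, and $$\frac{d}{dt}\int_{A(t)}\phi^\Sigma\,do=\int_{A(t)}\Big(\frac{D^\Sigma}{Dt}\phi^\Sigma+\phi^\Sigma\,\mathrm{div}_\Sigma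 v^\Sigma\Big)\,do .$$ Here $\frac{D^\Sigma}{Dt}\phi^\Sigma(t,x)$ is the derivative of $\phi^\Sigma$ at $(t,x)\in\mathcal M$ in the direction $(1,v^\Sigma(t,x))$, which is tangent to $\mathcal M$, and $\mathrm{div}_\Sigma v^\Sigma(t,x)=\sum_i\langle\partial_{\tau_i}v^\Sigma(t,x),\tau_i\rangle$ for an orthonormal basis $(\tau_i)$ of the tangent space of $\Sigma(t)$ at $x$. -/

import Mathlib

open Set MeasureTheory

noncomputable section

namespace MovingSurface

/-- A `C^k`-hypersurface (without boundary, embedded): locally the zero set of a `C^k`-function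
with nowhere vanishing differential. -/
def IsHypersurface {F : Type*} [NormedAddCommGroup F] [NormedSpace ℝ F]
    (k : WithTop ℕ∞) (S : Set F) : Prop :=
  ∀ p ∈ S, ∃ U : Set F, IsOpen U ∧ p ∈ U ∧ ∃ f : F → ℝ,
    ContDiffOn ℝ k f U ∧ (∀ x ∈ U, fderiv ℝ f x ≠ 0) ∧ S ∩ U = {x ∈ U | f x = 0}

/-- The tangent space of `S` at `p` (for a hypersurface the tangent cone is already a linear
subspace, so that the span adds nothing). -/
def tangentSpace {F : Type*} [NormedAddCommGroup F] [NormedSpace ℝ F]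
    (S : Set F) (p : F) : Submodule ℝ F :=
  Submodule.span ℝ (tangentConeAt ℝ S p)

variable {n : ℕ}

/-- The graph `{(t, x) : t ∈ J, x ∈ S t}` of a moving set. -/
def graph (J : Set ℝ) (S : ℝ → Set (EuclideanSpace ℝ (Fin n))) :
    Set (ℝ × EuclideanSpace ℝ (Fin n)) :=
  {p | p.1 ∈ J ∧ p.2 ∈ S p.1}

/-- The unit normal `ν^x / ‖ν^x‖` of the sections, where `ν = (ν^t, ν^x)` is the unit normal of
the graph. -/
def surfaceNormal (ν : ℝ × EuclideanSpace ℝ (Fin n) → ℝ × EuclideanSpace ℝ (Fin n))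
    (p : ℝ × EuclideanSpace ℝ (Fin n)) : EuclideanSpace ℝ (Fin n) :=
  ‖(ν p).2‖⁻¹ • (ν p).2

/-- The speed of normal displacement `- ν^t / ‖ν^x‖`. -/
def normalSpeed (ν : ℝ × EuclideanSpace ℝ (Fin n) → ℝ × EuclideanSpace ℝ (Fin n))
    (p : ℝ × EuclideanSpace ℝ (Fin n)) : ℝ :=
  -((ν p).1 / ‖(ν p).2‖)

/-- `S` is a `C^{1,2}`-family of moving hypersurfaces over the time interval `J`, oriented by the
unit normal field `ν = (ν^t, ν^x)` of its graph. The inner product on `ℝ × ℝⁿ` is the Euclidean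
one, written out in components. -/
structure IsC12Family (J : Set ℝ) (S : ℝ → Set (EuclideanSpace ℝ (Fin n)))
    (ν : ℝ × EuclideanSpace ℝ (Fin n) → ℝ × EuclideanSpace ℝ (Fin n)) : Prop where
  graph_hypersurface : IsHypersurface 1 (graph J S)
  normal_continuousOn : ContinuousOn ν (graph J S)
  normal_unit : ∀ p ∈ graph J S, (ν p).1 ^ 2 + ‖(ν p).2‖ ^ 2 = 1
  normal_orthogonal : ∀ p ∈ graph J S, ∀ w ∈ tangentSpace (graph J S) p,
    (ν p).1 * w.1 + inner ℝ (ν p).2 w.2 = 0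
  normal_space_ne_zero : ∀ p ∈ graph J S, (ν p).2 ≠ 0
  section_hypersurface : ∀ t ∈ J, IsHypersurface 2 (S t)
  surfaceNormal_contDiffOn : ContDiffOn ℝ 1 (surfaceNormal ν) (graph J S)

/-- `γ` solves `γ' = v(t, γ)` on `J` and stays on the moving surface. -/
def IsSurfaceTrajectory (J : Set ℝ) (S : ℝ → Set (EuclideanSpace ℝ (Fin n)))
    (v : ℝ × EuclideanSpace ℝ (Fin n) → EuclideanSpace ℝ (Fin n))
    (γ : ℝ → EuclideanSpace ℝ (Fin n)) : Prop :=
  ∀ t ∈ J, γ t ∈ S t ∧ HasDerivAt γ (v (t, γ t)) t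

/-- The image of `B` under the surface flow map from time `t₀` to time `t`. -/
def flowImage (J : Set ℝ) (S : ℝ → Set (EuclideanSpace ℝ (Fin n)))
    (v : ℝ × EuclideanSpace ℝ (Fin n) → EuclideanSpace ℝ (Fin n)) (t₀ t : ℝ)
    (B : Set (EuclideanSpace ℝ (Fin n))) : Set (EuclideanSpace ℝ (Fin n)) :=
  {y | ∃ γ, IsSurfaceTrajectory J S v γ ∧ γ t₀ ∈ B ∧ γ t = y}

/-- `B` is a compact `C^1`-submanifold with boundary of the hypersurface `S`, of the same
dimension as `S`: each point of `B` is an interior point relative to `S`, or a boundary point near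
which `B` is a sublevel set in `S` of a `C^1`-function whose surface differential is nonzero. -/
def IsC1Area (S B : Set (EuclideanSpace ℝ (Fin n))) : Prop :=
  B ⊆ S ∧ IsCompact B ∧ ∀ p ∈ B, ∃ U : Set (EuclideanSpace ℝ (Fin n)), IsOpen U ∧ p ∈ U ∧
    (B ∩ U = S ∩ U ∨
      ∃ g : EuclideanSpace ℝ (Fin n) → ℝ, ContDiffOn ℝ 1 g U ∧ g p = 0 ∧
        (∃ w ∈ tangentSpace S p, fderiv ℝ g p w ≠ 0) ∧ B ∩ U = {x ∈ S ∩ U | g x ≤ 0})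

/-- `A` is a family of co-moving areas with `C^1`-boundary: for some `t₀ ∈ J` the set `A t₀` is an
area with `C^1`-boundary in `S t₀`, the flow map is defined on `A t₀` for all times in `J`, and
`A t` is the image of `A t₀` under it. -/
def IsCoMovingAreaFamily (J : Set ℝ) (S : ℝ → Set (EuclideanSpace ℝ (Fin n)))
    (v : ℝ × EuclideanSpace ℝ (Fin n) → EuclideanSpace ℝ (Fin n))
    (A : ℝ → Set (EuclideanSpace ℝ (Fin n))) : Prop :=
  ∃ t₀ ∈ J, IsC1Area (S t₀) (A t₀) ∧
    (∀ x ∈ A t₀, ∃ γ, IsSurfaceTrajectory J S v γ ∧ γ t₀ = x) ∧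
    ∀ t ∈ J, A t = flowImage J S v t₀ t (A t₀)

/-- The surface divergence `∑ᵢ ⟨D_{τᵢ} u, τᵢ⟩` at `x`, for an orthonormal basis `τ` of the tangent
space. (The derivative of `u` within `S` is determined on tangent vectors.) -/
def surfaceDiv (S : Set (EuclideanSpace ℝ (Fin n)))
    (u : EuclideanSpace ℝ (Fin n) → EuclideanSpace ℝ (Fin n))
    (x : EuclideanSpace ℝ (Fin n)) : ℝ :=
  ∑ i, inner ℝ
    (fderivWithin ℝ u S x (stdOrthonormalBasis ℝ (tangentSpace S x) i : EuclideanSpace ℝ (Fin n)))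
    (stdOrthonormalBasis ℝ (tangentSpace S x) i : EuclideanSpace ℝ (Fin n))

/-- The surface material derivative at `(t, x)`: the derivative of `φ` within the graph in the
direction `(1, v(t, x))`, which is tangent to the graph if `v` is consistent. -/
def surfaceMaterialDeriv (J : Set ℝ) (S : ℝ → Set (EuclideanSpace ℝ (Fin n)))
    (v : ℝ × EuclideanSpace ℝ (Fin n) → EuclideanSpace ℝ (Fin n))
    (φ : ℝ × EuclideanSpace ℝ (Fin n) → ℝ) (p : ℝ × EuclideanSpace ℝ (Fin n)) : ℝ :=
  fderivWithin ℝ φ (graph J S) p (1, v p)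

end MovingSurface

end

/-!
The proof computes the derivative at a fixed time `t ∈ J` directly from the definition, by comparing
`A (t + h)` with `A t` through the flow map `Φ` along trajectories. It uses neither an area formula
for parametrized surfaces nor the differentiability of the flow in its initial value.

*Flow.* A `C¹`-hypersurface has local `C¹`-retractions (`exists_retraction`), so `v` and `φ` extend
locally to `C¹`-functions of the ambient variables. Strict differentiability of the extension of
`v` and the mean value inequality show that trajectories near a point of the graph separate at most
by a factor `2` in a short time, which gives uniqueness and continuous dependence over all of `J`
(`IsCoMovingAreaFamily.exists_flow`). In particular `A t` is compact. The same argument gives more: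
near a point of `A t`, the map `Φ` differs from `1 + h L`, where `L` is the spatial derivative of
`v`, by a map with Lipschitz constant `ε |h|` (`exists_flow_near_linear`).

*Area.* Fix `h ≠ 0`. On a piece `B` of `A t` so small that its secants are parallel to a tangent
space `P` up to an angle of order `ε |h|`, lengths of `Φ x - Φ y` and of `(1 + h M) π (x - y)` agree
up to the factor `1 + O(ε |h|)`; here `π` is the orthogonal projection to `P` and `M` the
compression of `L` to `P`, since the part of `h L` normal to `P` affects lengths only to second
order. Hausdorff measures are monotone under such comparisons, and on the inner product space `P`
the map `1 + h M` multiplies them by `det (1 + h M) = 1 + h tr M + o(h)`. Since `tr M` is the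
surface divergence, the area of `Φ '' B` is `1 + h div v` times that of `B`, up to `ε |h|`
(`exists_abs_measure_image_sub_le`).

*Integral.* Along trajectories `φ` grows at the rate of its material derivative, uniformly near each
point. With the expansion of the area this gives the expansion of the integral over `Φ '' B`, with
an error at most `ε |h|` times the area of `B` (`eventually_exists_abs_integral_sub_le`). All bounds
on `h` are uniform by compactness of `A t`. The size of the pieces depends on `h`, which is harmless
because the errors are proportional to the areas and add up (`abs_le_of_forall_local_abs_le`).
-/

namespace MovingSurface

open Module Filter Topology
open scoped NNReal ENNReal

/-! ### Euclidean Hausdorff measure under Lipschitz comparison and linear maps -/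

/-- Comparison of the images of one set under two maps `f` and `g`: if `f` expands distances at most
`K` times as much as `g` does, then `f '' s` has at most `K ^ d` times the measure of `g '' s`. -/
theorem euclideanHausdorffMeasure_image_le_of_dist_le {α X Y : Type*}
    [MetricSpace X] [MeasurableSpace X] [BorelSpace X]
    [MetricSpace Y] [MeasurableSpace Y] [BorelSpace Y] (d : ℕ) {f : α → Y} {g : α → X} {s : Set α}
    {K : ℝ} (hK : 0 ≤ K) (h : ∀ x ∈ s, ∀ y ∈ s, dist (f x) (f y) ≤ K * dist (g x) (g y)) :
    μHE[d] (f '' s) ≤ ENNReal.ofReal K ^ d * μHE[d] (g '' s) := by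
  rcases s.eq_empty_or_nonempty with rfl | ⟨x₀, -⟩
  · simp
  have : Nonempty α := ⟨x₀⟩
  lift K to ℝ≥0 using hK
  have himage : f '' s = (f ∘ Function.invFunOn g s) '' (g '' s) := by
    rw [image_image]
    refine image_congr fun x hx => ?_
    have hmem : g x ∈ g '' s := mem_image_of_mem g hx
    refine dist_le_zero.mp ((h x hx _ (Function.invFunOn_mem hmem)).trans_eq ?_)
    rw [Function.invFunOn_eq hmem, dist_self, mul_zero]
  have hlip : LipschitzOnWith K (f ∘ Function.invFunOn g s) (g '' s) := by
    refine LipschitzOnWith.of_dist_le_mul fun y hy z hz => ?_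
    have := h _ (Function.invFunOn_mem hy) _ (Function.invFunOn_mem hz)
    rwa [Function.invFunOn_eq hy, Function.invFunOn_eq hz] at this
  rw [himage, Measure.euclideanHausdorffMeasure_def, Measure.euclideanHausdorffMeasure_def,
    Measure.smul_apply, Measure.smul_apply, ENNReal.smul_def, ENNReal.smul_def, smul_eq_mul,
    smul_eq_mul, mul_left_comm, ENNReal.ofReal_coe_nnreal]
  gcongr
  simpa using hlip.hausdorffMeasure_image_le (d := (d : ℝ)) (by positivity)

theorem euclideanHausdorffMeasure_image_linearMap {V : Type*} [NormedAddCommGroup V]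
    [InnerProductSpace ℝ V] [FiniteDimensional ℝ V] [MeasurableSpace V] [BorelSpace V] {d : ℕ}
    (hd : finrank ℝ V = d) (M : V →ₗ[ℝ] V) (s : Set V) :
    μHE[d] (M '' s) = ENNReal.ofReal |LinearMap.det M| * μHE[d] s := by
  subst hd
  exact Measure.addHaar_image_linearMap _ M s

/-! ### First order expansion of the determinant -/

theorem differentiable_det_one_add (d : ℕ) :
    Differentiable ℝ fun A : Fin d → Fin d → ℝ => (1 + Matrix.of A).det := by
  simp only [Matrix.det_apply, Matrix.add_apply, Matrix.of_apply]
  fun_prop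

theorem fderiv_det_one_add (d : ℕ) (A : Fin d → Fin d → ℝ) :
    fderiv ℝ (fun A : Fin d → Fin d → ℝ => (1 + Matrix.of A).det) 0 A
      = (Matrix.of A).trace := by
  have h1 : HasDerivAt (fun r : ℝ => (1 + Matrix.of (r • A)).det)
      (fderiv ℝ (fun A : Fin d → Fin d → ℝ => (1 + Matrix.of A).det) 0 A) 0 := by
    have h0 : HasDerivAt (fun r : ℝ => r • A) A 0 := by
      simpa using (hasDerivAt_id (0 : ℝ)).smul_const A
    have h2 := (differentiable_det_one_add d ((0 : ℝ) • A)).hasFDerivAt.comp_hasDerivAt 0 h0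
    rw [zero_smul] at h2
    exact h2
  set q := (Matrix.det (1 + (Polynomial.X : Polynomial ℝ) •
    (Matrix.of A).map Polynomial.C)).divX.divX
  have h2 : HasDerivAt (fun r : ℝ => (1 + Matrix.of (r • A)).det) (Matrix.of A).trace 0 := by
    have h3 : (fun r : ℝ => (1 + Matrix.of (r • A)).det)
        = fun r => 1 + (Matrix.of A).trace * r + q.eval r * r ^ 2 := by
      funext r
      exact Matrix.det_one_add_smul r (Matrix.of A)
    rw [h3]
    have h4 := (((hasDerivAt_id (0 : ℝ)).const_mul (Matrix.of A).trace).const_add 1).add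
      ((q.hasDerivAt (0 : ℝ)).mul (hasDerivAt_pow 2 (0 : ℝ)))
    refine h4.congr_deriv ?_
    simp
  exact h1.unique h2

/-- The expansion `det (1 + h M) = 1 + h tr M + o(h)` holds uniformly for operators `M` of bounded
norm on inner product spaces of a fixed dimension. -/
theorem exists_abs_det_one_add_smul_sub_le (d : ℕ) (Λ : ℝ) {ε : ℝ} (hε : 0 < ε) :
    ∃ δ > 0, ∀ {V : Type} [NormedAddCommGroup V] [InnerProductSpace ℝ V]
      [FiniteDimensional ℝ V], finrank ℝ V = d → ∀ M : V →L[ℝ] V, ‖M‖ ≤ Λ → ∀ h : ℝ, |h| < δ →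
      |LinearMap.det (1 + h • (M : V →ₗ[ℝ] V)) - (1 + h * LinearMap.trace ℝ V M)| ≤ ε * |h| ∧
      |h * LinearMap.trace ℝ V M| ≤ 1 / 2 := by
  set D := fderiv ℝ (fun A : Fin d → Fin d → ℝ => (1 + Matrix.of A).det) 0 with hD
  -- in an orthonormal basis the entries of `M` are at most `Λ`, so that `h • M` lies in the ball in
  -- which the derivative at `0` approximates `A ↦ det (1 + A)`
  set Λ' := |Λ| + 1
  have hΛ' : 0 < Λ' := by positivity
  have h1 := (differentiable_det_one_add d 0).hasFDerivAt.isLittleO.def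
    (show 0 < ε / Λ' by positivity)
  have h2 : ∀ᶠ A in 𝓝 (0 : Fin d → Fin d → ℝ), |D A| ≤ 1 / 2 := by
    have : Tendsto (fun A => |D A|) (𝓝 0) (𝓝 |D 0|) := (D.continuous.abs).tendsto 0
    rw [map_zero, abs_zero] at this
    exact this.eventually (ge_mem_nhds (by norm_num))
  obtain ⟨r, hr, hball⟩ := Metric.eventually_nhds_iff.mp (h1.and h2)
  refine ⟨r / Λ', by positivity, fun {V} _ _ _ hV M hM h hh => ?_⟩
  set b : OrthonormalBasis (Fin d) ℝ V := (stdOrthonormalBasis ℝ V).reindex (finCongr hV)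
  set A : Matrix (Fin d) (Fin d) ℝ := LinearMap.toMatrix b.toBasis b.toBasis (M : V →ₗ[ℝ] V)
    with hA
  set A' : Fin d → Fin d → ℝ := fun i j => A i j with hA'
  have hofA' : Matrix.of A' = A := rfl
  have hnorm : ‖A'‖ ≤ Λ' := by
    refine (pi_norm_le_iff_of_nonneg hΛ'.le).mpr fun i =>
      (pi_norm_le_iff_of_nonneg hΛ'.le).mpr fun j => ?_
    have : A' i j = inner ℝ (b i) (M (b j)) := by
      simp [hA', hA, LinearMap.toMatrix_apply, OrthonormalBasis.repr_apply_apply]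
    rw [this]
    calc ‖inner ℝ (b i) (M (b j))‖ ≤ ‖b i‖ * ‖M (b j)‖ := norm_inner_le_norm _ _
      _ ≤ 1 * (Λ * 1) := by
        rw [b.norm_eq_one]
        gcongr
        simpa using M.le_of_opNorm_le hM (b j)
      _ ≤ Λ' := by linarith [le_abs_self Λ]
  have hhA : ‖h • A'‖ ≤ |h| * Λ' := by
    rw [norm_smul, Real.norm_eq_abs]
    gcongr
  have hlt : dist (h • A') 0 < r := by
    rw [dist_zero_right]
    exact hhA.trans_lt ((lt_div_iff₀ hΛ').mp hh)
  obtain ⟨h3, h4⟩ := hball hlt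
  have htr : LinearMap.trace ℝ V (M : V →ₗ[ℝ] V) = A.trace :=
    LinearMap.trace_eq_matrix_trace ℝ b.toBasis _
  have hdet : LinearMap.det (1 + h • (M : V →ₗ[ℝ] V)) = (1 + h • A).det := by
    rw [← LinearMap.det_toMatrix b.toBasis, map_add, map_smul, LinearMap.toMatrix_one]
  have hDA : D (h • A') = h * A.trace := by
    rw [map_smul, hD, fderiv_det_one_add, hofA', smul_eq_mul]
  rw [htr, hdet]
  constructor
  · rw [← hD, sub_zero, hDA] at h3
    have h5 : (1 + Matrix.of (h • A')).det - (1 + Matrix.of (0 : Fin d → Fin d → ℝ)).det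
        - h * A.trace = (1 + h • A).det - (1 + h * A.trace) := by
      rw [show Matrix.of (0 : Fin d → Fin d → ℝ) = 0 from rfl, add_zero, Matrix.det_one,
        show Matrix.of (h • A') = h • A from rfl]
      ring
    rw [h5, Real.norm_eq_abs] at h3
    refine h3.trans ?_
    calc ε / Λ' * ‖h • A'‖ ≤ ε / Λ' * (|h| * Λ') := by gcongr
      _ = ε * |h| := by field_simp
  · rwa [hDA] at h4

/-! ### Measure distortion of nearly linear maps on nearly flat sets -/

section Distortion

variable {E : Type} [NormedAddCommGroup E] [InnerProductSpace ℝ E] [FiniteDimensional ℝ E]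

/-- The compression `π_P ∘ L |_P` of an operator `L` to a subspace `P`; for `L` the derivative of a
vector field and `P` a tangent space, its trace is the surface divergence. -/
noncomputable def compression (P : Submodule ℝ E) (L : E →L[ℝ] E) : P →L[ℝ] P :=
  P.orthogonalProjectionOnto ∘L L ∘L P.subtypeL

theorem norm_compression_le (P : Submodule ℝ E) (L : E →L[ℝ] E) : ‖compression P L‖ ≤ ‖L‖ := by
  refine ContinuousLinearMap.opNorm_le_bound _ (norm_nonneg _) fun x => ?_
  calc ‖P.orthogonalProjectionOnto (L x)‖ ≤ ‖L x‖ := P.norm_orthogonalProjectionOnto_apply_le _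
    _ ≤ ‖L‖ * ‖x‖ := L.le_opNorm x

/-- The elementary inequalities behind `norm_le_of_near_linear`. -/
theorem stretch_bounds {k a x z X X' : ℝ} (hk0 : 0 ≤ k) (hk1 : k ≤ 1 / 16) (ha : 0 ≤ a)
    (hz : 0 ≤ z) (hxa : x ≤ (1 + 2 * k) * a) (haX : 3 / 4 * a ≤ X) (hXX' : X ≤ X')
    (hX'X : X' ≤ X + 4 / 3 * k * a) (hzX' : |z - X'| ≤ 3 * k * x) :
    z ≤ (1 + 16 * k) * X ∧ X ≤ (1 + 16 * k) * z ∧ x ≤ (1 + 16 * k) * a := by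
  obtain ⟨h1, h2⟩ := abs_le.mp hzX'
  have hka : k * a ≤ k * (4 / 3 * X) := mul_le_mul_of_nonneg_left (by linarith) hk0
  have hka0 : 0 ≤ k * a := mul_nonneg hk0 ha
  have hkx : k * x ≤ k * (9 / 8 * a) := by
    refine mul_le_mul_of_nonneg_left (hxa.trans ?_) hk0
    exact mul_le_mul_of_nonneg_right (by linarith) ha
  have hkz : 0 ≤ k * z := mul_nonneg hk0 hz
  refine ⟨by linarith, ?_, by linarith⟩
  have h3 : X * (1 - 8 * k) ≤ z := by linarith
  have h4 : 1 ≤ (1 + 16 * k) * (1 - 8 * k) := by nlinarith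
  calc X = 1 * X := (one_mul X).symm
    _ ≤ (1 + 16 * k) * (1 - 8 * k) * X :=
      mul_le_mul_of_nonneg_right h4 (by linarith)
    _ = (1 + 16 * k) * (X * (1 - 8 * k)) := by ring
    _ ≤ (1 + 16 * k) * z := mul_le_mul_of_nonneg_left h3 (by linarith)

/-- The elementary inequalities behind `exists_abs_measure_image_sub_le`. -/
theorem abs_sub_one_add_mul_le {b p f c D t e : ℝ} (hb : 0 ≤ b) (hf : 0 ≤ f) (he : 0 ≤ e)
    (he1 : e ≤ 1 / 8) (hc1 : 1 ≤ c) (hc2 : c ≤ 1 + e) (hD : |D - (1 + t)| ≤ e) (ht : |t| ≤ 1 / 2)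
    (hpb : p ≤ b) (hbp : b ≤ c * p) (hfD : f ≤ c * (D * p)) (hDf : D * p ≤ c * f) :
    |f - (1 + t) * b| ≤ 8 * e * b := by
  obtain ⟨d1, d2⟩ := abs_le.mp hD
  obtain ⟨t1, t2⟩ := abs_le.mp ht
  have hD0 : 0 ≤ D := by linarith
  have hD2 : D ≤ 2 := by linarith
  have hc0 : 0 ≤ c := by linarith
  have hDe : D * e ≤ 2 * e := mul_le_mul_of_nonneg_right hD2 he
  have hee : e * e ≤ 1 / 8 * e := mul_le_mul_of_nonneg_right he1 he
  rw [abs_le]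
  constructor
  · have h1 : D * b ≤ c * (c * f) :=
      calc D * b ≤ D * (c * p) := mul_le_mul_of_nonneg_left hbp hD0
        _ = c * (D * p) := by ring
        _ ≤ c * (c * f) := mul_le_mul_of_nonneg_left hDf hc0
    have h2 : c * c ≤ 1 + 3 * e := by
      calc c * c ≤ (1 + e) * (1 + e) := by gcongr
        _ ≤ 1 + 3 * e := by linarith
    have h3 : D * b ≤ (1 + 3 * e) * f := by
      refine h1.trans ?_
      rw [← mul_assoc]
      exact mul_le_mul_of_nonneg_right h2 hf
    have h4 : (1 - 3 * e) * (D * b) ≤ f := by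
      have h5 := mul_le_mul_of_nonneg_left h3 (show 0 ≤ 1 - 3 * e by linarith)
      have h6 : 0 ≤ e * e * f := by positivity
      linarith
    have h5 : 1 + t - 8 * e ≤ (1 - 3 * e) * D := by linarith
    have h6 := mul_le_mul_of_nonneg_right h5 hb
    linarith
  · have h1 : f ≤ c * (D * b) := hfD.trans (by gcongr)
    have h2 : c * D ≤ 1 + t + 8 * e := by
      have := mul_le_mul_of_nonneg_right hc2 hD0
      linarith
    have h3 := mul_le_mul_of_nonneg_right h2 hb
    linarith

/-- The component of `L` normal to `P` changes lengths only to second order in `h`: on vectors `ξ`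
almost in `P`, the operator `1 + h L` and any map close to it stretch lengths like `1 + h M` on
`P`, where `M` is the compression of `L` to `P`. -/
theorem norm_le_of_near_linear (P : Submodule ℝ E) (L : E →L[ℝ] E) {Λ η h : ℝ}
    (hL : ‖L‖ ≤ Λ) (hη : 0 < η) (hη' : η ≤ 1 / 16) (hh : |h| ≤ 1) (hh1 : |h| * Λ ≤ 1 / 4)
    (hh2 : |h| * Λ ^ 2 ≤ η) {ξ ζ : E} (hζ : ‖ζ - ξ - h • L ξ‖ ≤ η * |h| * ‖ξ‖)
    (hξ : ‖ξ - P.starProjection ξ‖ ≤ η * |h| * ‖ξ‖) :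
    let a := P.orthogonalProjectionOnto ξ
    ‖ζ‖ ≤ (1 + 16 * η * |h|) * ‖a + h • compression P L a‖ ∧
    ‖a + h • compression P L a‖ ≤ (1 + 16 * η * |h|) * ‖ζ‖ ∧
    ‖ξ‖ ≤ (1 + 16 * η * |h|) * ‖a‖ := by
  intro a
  set k := η * |h| with hk
  have hΛ : 0 ≤ Λ := (norm_nonneg _).trans hL
  have hk0 : 0 ≤ k := by positivity
  have hk1 : k ≤ 1 / 16 := by
    calc k ≤ 1 / 16 * 1 := by rw [hk]; gcongr
      _ = 1 / 16 := by ring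
  have haP : P.starProjection ξ = (a : E) := rfl
  rw [haP] at hξ
  have hnorma : ‖(a : E)‖ = ‖a‖ := rfl
  set X := ‖a + h • compression P L a‖ with hX
  set X' := ‖(a : E) + h • L a‖ with hX'
  have hξa : ‖ξ‖ ≤ ‖a‖ + k * ‖ξ‖ := by
    calc ‖ξ‖ = ‖(a : E) + (ξ - a)‖ := by congr 1; abel
      _ ≤ _ := (norm_add_le _ _).trans (by rw [hnorma]; gcongr)
  have hξ2 : ‖ξ‖ ≤ (1 + 2 * k) * ‖a‖ := by
    nlinarith [norm_nonneg ξ, norm_nonneg a, mul_nonneg hk0 (norm_nonneg ξ)]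
  have hLa : ‖L a‖ ≤ Λ * ‖a‖ := (L.le_opNorm _).trans (by rw [hnorma]; gcongr)
  have haX : 3 / 4 * ‖a‖ ≤ X := by
    have h1 : ‖a‖ ≤ X + |h| * (Λ * ‖a‖) := by
      calc ‖a‖ = ‖(a + h • compression P L a) - h • compression P L a‖ := by congr 1; abel
        _ ≤ X + ‖h • compression P L a‖ := norm_sub_le _ _
        _ ≤ _ := by
          rw [norm_smul, Real.norm_eq_abs]
          gcongr
          exact (P.norm_orthogonalProjectionOnto_apply_le _).trans hLa
    nlinarith [norm_nonneg a]
  have hpyth : X' ^ 2 = X ^ 2 + h ^ 2 * ‖L a - P.starProjection (L a)‖ ^ 2 := by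
    have h1 : (a : E) + h • L a = ((a + h • compression P L a : P) : E)
        + h • (L a - P.starProjection (L a)) := by
      simp only [Submodule.coe_add, Submodule.coe_smul, compression,
        ContinuousLinearMap.comp_apply, Submodule.subtypeL_apply,
        Submodule.starProjection_apply, smul_sub]
      abel
    have h2 : inner ℝ ((a + h • compression P L a : P) : E)
        (h • (L a - P.starProjection (L a))) = 0 := by
      rw [inner_smul_right]
      have := (Submodule.mem_orthogonal P _).mp (P.sub_starProjection_mem_orthogonal (L a)) _
        (a + h • compression P L a).2
      rw [this, mul_zero]
    have h3 := norm_add_sq_eq_norm_sq_add_norm_sq_of_inner_eq_zero _ _ h2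
    rw [← h1] at h3
    rw [pow_two, h3, norm_smul, Real.norm_eq_abs, hX, Submodule.norm_coe]
    rw [← sq_abs h]
    ring
  have hres : ‖L a - P.starProjection (L a)‖ ≤ Λ * ‖a‖ := by
    have h1 : L a - P.starProjection (L a) = Pᗮ.starProjection (L a) := by
      rw [Submodule.starProjection_orthogonal']
      simp
    rw [h1]
    exact (Pᗮ.norm_starProjection_apply_le _).trans hLa
  have hXX' : X ≤ X' := by
    refine abs_le_of_sq_le_sq' ?_ (norm_nonneg _) |>.2
    rw [hpyth]
    nlinarith [mul_nonneg (sq_nonneg h) (sq_nonneg ‖L a - P.starProjection (L a)‖)]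
  have hX0 : 0 ≤ X := norm_nonneg _
  have hX'X : X' ≤ X + 4 / 3 * k * ‖a‖ := by
    have h1 : h ^ 2 * ‖L a - P.starProjection (L a)‖ ^ 2 ≤ k * ‖a‖ ^ 2 := by
      calc h ^ 2 * ‖L a - P.starProjection (L a)‖ ^ 2 ≤ h ^ 2 * (Λ * ‖a‖) ^ 2 := by gcongr
        _ = (|h| * Λ ^ 2) * |h| * ‖a‖ ^ 2 := by rw [← sq_abs h]; ring
        _ ≤ η * |h| * ‖a‖ ^ 2 := by gcongr
    refine abs_le_of_sq_le_sq' ?_ (by positivity) |>.2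
    rw [hpyth]
    nlinarith [mul_nonneg hk0 (norm_nonneg a), sq_nonneg (4 / 3 * k * ‖a‖),
      mul_le_mul_of_nonneg_left haX (mul_nonneg hk0 (norm_nonneg a))]
  have hζX' : |‖ζ‖ - X'| ≤ 3 * k * ‖ξ‖ := by
    refine (abs_norm_sub_norm_le _ _).trans ?_
    have h1 : ζ - ((a : E) + h • L a)
        = (ζ - ξ - h • L ξ) + ((ξ - a) + h • L (ξ - a)) := by
      rw [map_sub, smul_sub]; abel
    have h2 : ‖h • L (ξ - a)‖ ≤ 1 * (k * ‖ξ‖) := by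
      rw [norm_smul, Real.norm_eq_abs]
      calc |h| * ‖L (ξ - a)‖ ≤ |h| * (Λ * ‖ξ - a‖) := by
            gcongr
            exact (L.le_opNorm _).trans (by gcongr)
        _ = |h| * Λ * ‖ξ - a‖ := by ring
        _ ≤ 1 * (k * ‖ξ‖) := by gcongr; linarith
    rw [h1]
    have := norm_add_le (ζ - ξ - h • L ξ) ((ξ - a) + h • L (ξ - a))
    have := norm_add_le (ξ - a) (h • L (ξ - (a : E)))
    linarith
  have e : 16 * η * |h| = 16 * k := by rw [hk]; ring
  rw [e]
  exact stretch_bounds hk0 hk1 (norm_nonneg a) (norm_nonneg ζ) hξ2 haX hXX' hX'X hζX'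

theorem one_add_pow_le (d : ℕ) {x : ℝ} (hx : 0 ≤ x) (hx1 : x ≤ 1) :
    (1 + x) ^ d ≤ 1 + 3 ^ d * x := by
  induction d with
  | zero => simp [hx]
  | succ d ih =>
    have h1 : (1 : ℝ) ≤ 3 ^ d := one_le_pow₀ (by norm_num)
    have h3 : 3 ^ d * x * x ≤ 3 ^ d * x := mul_le_of_le_one_right (by positivity) hx1
    have h4 : x ≤ 3 ^ d * x := le_mul_of_one_le_left hx h1
    calc (1 + x) ^ (d + 1) = (1 + x) ^ d * (1 + x) := pow_succ _ _
      _ ≤ (1 + 3 ^ d * x) * (1 + x) := by gcongr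
      _ ≤ 1 + 3 ^ (d + 1) * x := by rw [pow_succ]; linarith

variable [MeasurableSpace E] [BorelSpace E]

/-- A set whose secants are almost parallel to `P` has, up to the factor `(1 + κ) ^ d`, the
measure of its projection to `P`. -/
theorem euclideanHausdorffMeasure_le_projection (P : Submodule ℝ E) (d : ℕ) {κ : ℝ} (hκ : 0 ≤ κ)
    {B : Set E} (hB : ∀ x ∈ B, ∀ y ∈ B,
      ‖x - y‖ ≤ (1 + κ) * ‖P.orthogonalProjectionOnto (x - y)‖) :
    μHE[d] B ≤ ENNReal.ofReal (1 + κ) ^ d * μHE[d] (P.orthogonalProjectionOnto '' B) := by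
  have := euclideanHausdorffMeasure_image_le_of_dist_le d (f := id) (s := B)
    (g := P.orthogonalProjectionOnto) (K := 1 + κ) (by positivity) fun x hx y hy => by
      rw [dist_eq_norm, dist_eq_norm, ← map_sub]
      exact hB x hx y hy
  simpa using this

/-- **Infinitesimal area distortion.** Let `B` be a set whose secants are almost parallel to a
`d`-dimensional subspace `P`, and let `Φ` be close to `1 + h L` in the Lipschitz sense on `B`. Then
`Φ` multiplies the `d`-dimensional measure of `B` by `1 + h tr (π_P L|_P)` up to `ε |h|`, for all
small `h`, with bounds depending on `d` and a bound for `‖L‖` only. -/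
theorem exists_abs_measure_image_sub_le (d : ℕ) (Λ : ℝ) {ε : ℝ} (hε : 0 < ε) :
    ∃ η > 0, ∃ δ > 0, ∀ (P : Submodule ℝ E), finrank ℝ P = d → ∀ L : E →L[ℝ] E, ‖L‖ ≤ Λ →
      ∀ h : ℝ, |h| < δ → ∀ (Φ : E → E) (B : Set E), μHE[d] B ≠ ∞ →
      (∀ x ∈ B, ∀ y ∈ B, ‖Φ x - Φ y - (x - y) - h • L (x - y)‖ ≤ η * |h| * ‖x - y‖) →
      (∀ x ∈ B, ∀ y ∈ B, ‖(x - y) - P.starProjection (x - y)‖ ≤ η * |h| * ‖x - y‖) →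
      μHE[d] (Φ '' B) ≠ ∞ ∧
      |(μHE[d]).real (Φ '' B)
          - (1 + h * LinearMap.trace ℝ P (compression P L)) * (μHE[d]).real B|
        ≤ ε * |h| * (μHE[d]).real B := by
  obtain ⟨δ₁, hδ₁, hdet⟩ := exists_abs_det_one_add_smul_sub_le d Λ (ε := ε / 8) (by positivity)
  set η := min (1 / 16) (ε / (8 * 16 * 3 ^ d)) with hη
  have hη0 : 0 < η := by positivity
  set δ := min (min δ₁ 1) (min (min (1 / (4 * (|Λ| + 1))) (η / (Λ ^ 2 + 1))) (1 / (ε + 1))) with hδ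
  refine ⟨η, hη0, δ, by positivity, fun P hP L hL h hh Φ B hBfin hΦ hflat => ?_⟩
  have hΛ0 : 0 ≤ Λ := (norm_nonneg _).trans hL
  simp only [hδ, lt_min_iff] at hh
  obtain ⟨⟨hh1, hh2⟩, ⟨hh3, hh4⟩, hh5⟩ := hh
  have hhΛ : |h| * Λ ≤ 1 / 4 := by
    rw [lt_div_iff₀ (by positivity), abs_of_nonneg hΛ0] at hh3
    nlinarith [abs_nonneg h]
  have hhΛ2 : |h| * Λ ^ 2 ≤ η := by
    rw [lt_div_iff₀ (by positivity)] at hh4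
    nlinarith [abs_nonneg h]
  have hhε : ε * |h| ≤ 1 := by
    rw [lt_div_iff₀ (by positivity)] at hh5
    nlinarith [abs_nonneg h]
  set M := compression P L
  obtain ⟨hdet1, hdet2⟩ := hdet hP M ((norm_compression_le P L).trans hL) h hh1
  set D := LinearMap.det (1 + h • (M : P →ₗ[ℝ] P)) with hD
  set τ := LinearMap.trace ℝ P (M : P →ₗ[ℝ] P) with hτ
  set κ := 16 * η * |h| with hκ
  have hκ0 : 0 ≤ κ := by positivity
  have hκ1 : κ ≤ 1 := by
    calc 16 * η * |h| ≤ 16 * (1 / 16) * 1 := by gcongr; exact min_le_left _ _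
      _ = 1 := by norm_num
  set c := (1 + κ) ^ d with hc
  have hc1 : 1 ≤ c := one_le_pow₀ (by linarith)
  have hc2 : c ≤ 1 + ε / 8 * |h| := by
    refine (one_add_pow_le d hκ0 hκ1).trans ?_
    have : 3 ^ d * κ ≤ ε / 8 * |h| := by
      calc 3 ^ d * κ ≤ 3 ^ d * (16 * (ε / (8 * 16 * 3 ^ d)) * |h|) := by
            rw [hκ]; gcongr; exact min_le_right _ _
        _ = ε / 8 * |h| := by field_simp
    linarith
  have key : ∀ x ∈ B, ∀ y ∈ B, _ := fun x hx y hy =>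
    norm_le_of_near_linear P L hL hη0 (min_le_left _ _) hh2.le hhΛ hhΛ2 (hΦ x hx y hy)
      (hflat x hx y hy)
  set π := P.orthogonalProjectionOnto
  set G : E → P := fun x => (1 + h • (M : P →ₗ[ℝ] P)) (π x) with hG
  have hGsub : ∀ x y, G x - G y = π (x - y) + h • M (π (x - y)) := by
    intro x y
    simp only [hG, ← map_sub]
    simp
  have ofReal_c : ENNReal.ofReal (1 + κ) ^ d = ENNReal.ofReal c := by
    rw [hc, ENNReal.ofReal_pow (by positivity)]
  -- compare `B` with `π '' B`, and `Φ '' B` with the image `G '' B` of `π '' B` under `1 + h M`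
  have i1 : μHE[d] (π '' B) ≤ μHE[d] B := by
    have := euclideanHausdorffMeasure_image_le_of_dist_le d (f := π) (s := B) (g := id) (K := 1)
      zero_le_one fun x hx y hy => by
        rw [dist_eq_norm, dist_eq_norm, ← map_sub, one_mul]
        exact P.norm_orthogonalProjectionOnto_apply_le _
    simpa using this
  have i2 : μHE[d] B ≤ ENNReal.ofReal c * μHE[d] (π '' B) := by
    rw [← ofReal_c]
    exact euclideanHausdorffMeasure_le_projection P d hκ0 fun x hx y hy => (key x hx y hy).2.2
  have i3 : μHE[d] (Φ '' B) ≤ ENNReal.ofReal c * μHE[d] (G '' B) := by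
    rw [← ofReal_c]
    refine euclideanHausdorffMeasure_image_le_of_dist_le d (by positivity) fun x hx y hy => ?_
    rw [dist_eq_norm, dist_eq_norm, hGsub]
    exact (key x hx y hy).1
  have i4 : μHE[d] (G '' B) ≤ ENNReal.ofReal c * μHE[d] (Φ '' B) := by
    rw [← ofReal_c]
    refine euclideanHausdorffMeasure_image_le_of_dist_le d (by positivity) fun x hx y hy => ?_
    rw [dist_eq_norm, dist_eq_norm, hGsub]
    exact (key x hx y hy).2.1
  have i5 : μHE[d] (G '' B) = ENNReal.ofReal |D| * μHE[d] (π '' B) := by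
    rw [hD, ← euclideanHausdorffMeasure_image_linearMap hP, image_image]
  have fin1 : μHE[d] (π '' B) ≠ ∞ := ne_top_of_le_ne_top hBfin i1
  have fin2 : μHE[d] (G '' B) ≠ ∞ := by
    rw [i5]; exact ENNReal.mul_ne_top ENNReal.ofReal_ne_top fin1
  have fin3 : μHE[d] (Φ '' B) ≠ ∞ :=
    ne_top_of_le_ne_top (ENNReal.mul_ne_top ENNReal.ofReal_ne_top fin2) i3
  refine ⟨fin3, ?_⟩
  have toReal_le : ∀ {u w : ℝ≥0∞}, w ≠ ∞ → u ≤ ENNReal.ofReal c * w →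
      u.toReal ≤ c * w.toReal := by
    intro u w hw huw
    have := ENNReal.toReal_mono (ENNReal.mul_ne_top ENNReal.ofReal_ne_top hw) huw
    rwa [ENNReal.toReal_mul, ENNReal.toReal_ofReal (by positivity)] at this
  have r1 : (μHE[d] (π '' B)).toReal ≤ (μHE[d] B).toReal := ENNReal.toReal_mono hBfin i1
  have r2 := toReal_le fin1 i2
  have r3 := toReal_le fin2 i3
  have r4 := toReal_le fin3 i4
  have r5 : (μHE[d] (G '' B)).toReal = |D| * (μHE[d] (π '' B)).toReal := by
    rw [i5, ENNReal.toReal_mul, ENNReal.toReal_ofReal (abs_nonneg _)]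
  simp only [Measure.real]
  rw [r5] at r3 r4
  have he1 : ε / 8 * |h| ≤ 1 / 8 := by linarith
  have hD0 : 0 ≤ D := by
    have h1 := (abs_le.mp hdet1).1
    have h2 := (abs_le.mp hdet2).1
    linarith
  rw [abs_of_nonneg hD0] at r3 r4
  have e8 : ε * |h| = 8 * (ε / 8 * |h|) := by ring
  rw [e8]
  exact abs_sub_one_add_mul_le ENNReal.toReal_nonneg ENNReal.toReal_nonneg (by positivity) he1 hc1
    hc2 hdet1 hdet2 r1 r2 r3 r4

end Distortion

/-! ### Local geometry of hypersurfaces -/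

section Hypersurface

variable {F : Type*} [NormedAddCommGroup F] [NormedSpace ℝ F]

theorem IsHypersurface.of_le {k m : WithTop ℕ∞} {S : Set F} (hS : IsHypersurface k S)
    (hmk : m ≤ k) : IsHypersurface m S := by
  intro p hp
  obtain ⟨U, hU, hpU, f, hf, hf', hSU⟩ := hS p hp
  exact ⟨U, hU, hpU, f, hf.of_le hmk, hf', hSU⟩

/-- Near each of its points `p`, a `C¹`-hypersurface `S = {f = 0}` admits a `C¹`-retraction `ρ` of
the ambient space, whose differential at `p` fixes the kernel of the differential of `f`. With
`e = f'(p)`, `e w = 1`, the map `G x = x - e(x) w + f(x) w` straightens `S` to a level set of `e`,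
and `ρ` is the projection along `w` in these coordinates. -/
theorem exists_retraction [CompleteSpace F] {S U : Set F} {f : F → ℝ} {p : F} (hU : IsOpen U)
    (hpU : p ∈ U) (hf : ContDiffOn ℝ 1 f U) (hf' : fderiv ℝ f p ≠ 0) (hfp : f p = 0)
    (hSU : S ∩ U = {x ∈ U | f x = 0}) :
    ∃ ρ : F → F, ContDiffAt ℝ 1 ρ p ∧ (∀ᶠ x in 𝓝 p, ρ x ∈ S) ∧ (∀ᶠ x in 𝓝[S] p, ρ x = x) ∧
      ρ p = p ∧ ∀ v, fderiv ℝ f p v = 0 → fderiv ℝ ρ p v = v := by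
  set e := fderiv ℝ f p with he
  obtain ⟨w, hw⟩ : ∃ w, e w = 1 := by
    obtain ⟨u, hu⟩ : ∃ u, e u ≠ 0 := by
      by_contra! h
      exact hf' (ContinuousLinearMap.ext h)
    exact ⟨(e u)⁻¹ • u, by simp [hu]⟩
  have hfp1 : ContDiffAt ℝ 1 f p := hf.contDiffAt (hU.mem_nhds hpU)
  have hfd : HasFDerivAt f e p := (hfp1.differentiableAt one_ne_zero).hasFDerivAt
  set G : F → F := fun x => x - e x • w + f x • w with hG
  have hGc : ContDiffAt ℝ 1 G p := by
    refine (contDiffAt_id.sub (e.contDiff.contDiffAt.smul contDiffAt_const)).add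
      (hfp1.smul contDiffAt_const)
  have hGd : HasFDerivAt G ((ContinuousLinearEquiv.refl ℝ F : F ≃L[ℝ] F) : F →L[ℝ] F) p := by
    have h1 := ((hasFDerivAt_id p).sub (e.hasFDerivAt.smul_const w)).add (hfd.smul_const w)
    refine h1.congr_fderiv ?_
    ext v
    simp
  have hstrict := hGc.hasStrictFDerivAt' hGd one_ne_zero
  set g := hGc.localInverse hGd one_ne_zero with hg
  have hgc : ContDiffAt ℝ 1 g (G p) := hGc.to_localInverse hGd one_ne_zero
  have hgp : g (G p) = p := hGc.localInverse_apply_image hGd one_ne_zero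
  have hgd : HasFDerivAt g (ContinuousLinearMap.id ℝ F) (G p) := hstrict.to_localInverse.hasFDerivAt
  have hleft : ∀ᶠ x in 𝓝 p, g (G x) = x := hstrict.eventually_left_inverse
  have hright : ∀ᶠ y in 𝓝 (G p), G (g y) = y := hstrict.eventually_right_inverse
  have heG : ∀ x, e (G x) = f x := fun x => by simp [hG, hw]
  set q : F → F := fun x => G x - f x • w with hq
  have hqp : q p = G p := by simp [hq, hfp]
  have hqc : ContDiffAt ℝ 1 q p := hGc.sub (hfp1.smul contDiffAt_const)
  have hqd : HasFDerivAt q (ContinuousLinearMap.id ℝ F - e.smulRight w) p :=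
    hGd.sub (hfd.smul_const w)
  have hqt : Tendsto q (𝓝 p) (𝓝 (G p)) := hqp ▸ hqc.continuousAt.tendsto
  have hgt : Tendsto g (𝓝 (G p)) (𝓝 p) := by
    have := hgc.continuousAt.tendsto
    rwa [hgp] at this
  refine ⟨g ∘ q, ?_, ?_, ?_, ?_, ?_⟩
  · exact ContDiffAt.comp p (by rwa [hqp]) hqc
  · filter_upwards [hqt.eventually hright, (hgt.comp hqt).eventually (hU.mem_nhds hpU)] with x h1 h2
    have h3 : f (g (q x)) = 0 := by
      rw [← heG, h1, hq, map_sub, heG, map_smul, hw]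
      simp
    have h4 : g (q x) ∈ S ∩ U := by
      rw [hSU]
      exact ⟨h2, h3⟩
    exact h4.1
  · filter_upwards [nhdsWithin_le_nhds hleft, nhdsWithin_le_nhds (hU.mem_nhds hpU),
      self_mem_nhdsWithin] with x h1 h2 h3
    have h4 : x ∈ {x ∈ U | f x = 0} := hSU ▸ ⟨h3, h2⟩
    simp only [Function.comp_apply, hq, h4.2, zero_smul, sub_zero, h1]
  · simp [hqp, hgp]
  · intro v hv
    have h1 : HasFDerivAt (g ∘ q) ((ContinuousLinearMap.id ℝ F).comp
        (ContinuousLinearMap.id ℝ F - e.smulRight w)) p :=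
      HasFDerivAt.comp p (by rwa [hqp]) hqd
    rw [h1.fderiv]
    simp [hv]

/-- A `C¹`-function on a `C¹`-hypersurface extends to a `C¹`-function near each point. -/
theorem IsHypersurface.exists_contDiffAt_extension [CompleteSpace F] {S : Set F}
    (hS : IsHypersurface 1 S) {p : F} (hp : p ∈ S) {G : Type*} [NormedAddCommGroup G]
    [NormedSpace ℝ G] {u : F → G} (hu : ContDiffOn ℝ 1 u S) :
    ∃ u' : F → G, ContDiffAt ℝ 1 u' p ∧ ∀ᶠ x in 𝓝[S] p, u x = u' x := by
  obtain ⟨U, hU, hpU, f, hf, hf', hSU⟩ := hS p hp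
  have hfp : f p = 0 := (hSU ▸ (⟨hp, hpU⟩ : p ∈ S ∩ U) : p ∈ {x ∈ U | f x = 0}).2
  obtain ⟨ρ, hρ, hρS, hρid, hρp, -⟩ := exists_retraction hU hpU hf (hf' p hpU) hfp hSU
  refine ⟨u ∘ ρ, ?_, hρid.mono fun x hx => by simp [hx]⟩
  have h1 : ContDiffWithinAt ℝ 1 u S (ρ p) := hρp.symm ▸ hu p hp
  exact (h1.comp p (s := {x | ρ x ∈ S}) hρ.contDiffWithinAt fun x hx => hx).contDiffAt hρS

/-- The tangent space of a level set is the kernel of the differential. -/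
theorem tangentSpace_eq_ker [CompleteSpace F] {S U : Set F} {f : F → ℝ} {p : F} (hU : IsOpen U)
    (hpU : p ∈ U) (hf : ContDiffOn ℝ 1 f U) (hf' : fderiv ℝ f p ≠ 0) (hfp : f p = 0)
    (hSU : S ∩ U = {x ∈ U | f x = 0}) :
    tangentSpace S p = LinearMap.ker (fderiv ℝ f p : F →ₗ[ℝ] ℝ) := by
  apply le_antisymm
  · refine Submodule.span_le.mpr fun v hv => ?_
    have hfp1 : ContDiffAt ℝ 1 f p := hf.contDiffAt (hU.mem_nhds hpU)
    have h1 : HasFDerivWithinAt f (fderiv ℝ f p) S p :=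
      (hfp1.differentiableAt one_ne_zero).hasFDerivAt.hasFDerivWithinAt
    have h2 : HasFDerivWithinAt f (0 : F →L[ℝ] ℝ) S p := by
      refine (hasFDerivWithinAt_const (0 : ℝ) p S).congr_of_eventuallyEq ?_ hfp
      filter_upwards [nhdsWithin_le_nhds (hU.mem_nhds hpU), self_mem_nhdsWithin] with x hxU hxS
      exact (hSU ▸ (⟨hxS, hxU⟩ : x ∈ S ∩ U) : x ∈ {x ∈ U | f x = 0}).2
    exact h1.unique_on h2 hv
  · intro v hv
    obtain ⟨ρ, hρ, hρS, -, hρp, hρd⟩ := exists_retraction hU hpU hf hf' hfp hSU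
    refine Submodule.subset_span ?_
    have hc : HasDerivAt (fun s : ℝ => p + s • v) v 0 := by
      simpa using ((hasDerivAt_id (0 : ℝ)).smul_const v).const_add p
    have hc0 : p + (0 : ℝ) • v = p := by simp
    have hρd' : HasFDerivAt ρ (fderiv ℝ ρ p) (p + (0 : ℝ) • v) := by
      rw [hc0]
      exact (hρ.differentiableAt one_ne_zero).hasFDerivAt
    have h1 : HasDerivAt (fun s : ℝ => ρ (p + s • v)) v 0 := by
      have := hρd'.comp_hasDerivAt (0 : ℝ) hc
      rwa [hρd v hv] at this
    have hnhds : {s : ℝ | ρ (p + s • v) ∈ S} ∈ 𝓝 (0 : ℝ) := by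
      have h2 := hc.continuousAt.tendsto
      rw [hc0] at h2
      exact h2.eventually hρS
    have h2 := (h1.hasFDerivAt.hasFDerivWithinAt
      (s := {s : ℝ | ρ (p + s • v) ∈ S})).mapsTo_tangent_cone
    rw [tangentConeAt_of_mem_nhds hnhds] at h2
    have h3 := h2 (mem_univ (1 : ℝ))
    simp only [zero_smul, add_zero, hρp] at h3
    have h4 : v ∈ tangentConeAt ℝ ((fun s : ℝ => ρ (p + s • v)) '' {s | ρ (p + s • v) ∈ S}) p := by
      simpa using h3
    exact tangentConeAt_mono (image_subset_iff.mpr fun s hs => hs) h4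

end Hypersurface

section Euclidean

variable {E : Type} [NormedAddCommGroup E] [InnerProductSpace ℝ E] [FiniteDimensional ℝ E]

theorem IsHypersurface.finrank_tangentSpace_add_one {S : Set E} (hS : IsHypersurface 1 S) {p : E}
    (hp : p ∈ S) : finrank ℝ (tangentSpace S p) + 1 = finrank ℝ E := by
  have := FiniteDimensional.complete ℝ E
  obtain ⟨U, hU, hpU, f, hf, hf', hSU⟩ := hS p hp
  have hfp : f p = 0 := (hSU ▸ (⟨hp, hpU⟩ : p ∈ S ∩ U) : p ∈ {x ∈ U | f x = 0}).2
  rw [tangentSpace_eq_ker hU hpU hf (hf' p hpU) hfp hSU]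
  refine Module.Dual.finrank_ker_add_one_of_ne_zero (f := (fderiv ℝ f p : E →ₗ[ℝ] ℝ)) ?_
  intro h
  exact hf' p hpU (ContinuousLinearMap.coe_injective h)

/-- Secants of a `C¹`-hypersurface near `p` are almost parallel to the tangent space at `p`. -/
theorem IsHypersurface.exists_ball_norm_sub_projection_le {S : Set E} (hS : IsHypersurface 1 S)
    {p : E} (hp : p ∈ S) {c : ℝ} (hc : 0 < c) :
    ∃ r > 0, ∀ x ∈ S ∩ Metric.ball p r, ∀ y ∈ S ∩ Metric.ball p r,
      ‖(x - y) - (tangentSpace S p).starProjection (x - y)‖ ≤ c * ‖x - y‖ := by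
  have := FiniteDimensional.complete ℝ E
  obtain ⟨U, hU, hpU, f, hf, hf', hSU⟩ := hS p hp
  have hf0 : ∀ x ∈ S, x ∈ U → f x = 0 := fun x hx hxU =>
    (hSU ▸ (⟨hx, hxU⟩ : x ∈ S ∩ U) : x ∈ {x ∈ U | f x = 0}).2
  set P := tangentSpace S p with hP
  have hker : P = LinearMap.ker (fderiv ℝ f p : E →ₗ[ℝ] ℝ) :=
    tangentSpace_eq_ker hU hpU hf (hf' p hpU) (hf0 p hp hpU) hSU
  set e := fderiv ℝ f p
  obtain ⟨w, hw⟩ : ∃ w, e w = 1 := by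
    obtain ⟨u, hu⟩ : ∃ u, e u ≠ 0 := by
      by_contra! h
      exact hf' p hpU (ContinuousLinearMap.ext h)
    exact ⟨(e u)⁻¹ • u, by simp [hu]⟩
  have hfp1 : ContDiffAt ℝ 1 f p := hf.contDiffAt (hU.mem_nhds hpU)
  have hstrict := (hfp1.hasStrictFDerivAt one_ne_zero).isLittleO.def
    (show 0 < c / (‖w‖ + 1) by positivity)
  have hUU : ∀ᶠ z in 𝓝 (p, p), z.1 ∈ U ∧ z.2 ∈ U :=
    (hU.prod hU).mem_nhds (show ((p, p) : E × E) ∈ U ×ˢ U from ⟨hpU, hpU⟩)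
  obtain ⟨r, hr, hball⟩ := Metric.eventually_nhds_iff_ball.mp (hstrict.and hUU)
  refine ⟨r, hr, fun x hx y hy => ?_⟩
  obtain ⟨h1, h2⟩ := hball (x, y) (by
    rw [← ball_prod_same]
    exact ⟨hx.2, hy.2⟩)
  simp only [hf0 x hx.1 h2.1, hf0 y hy.1 h2.2, sub_self, zero_sub, norm_neg] at h1
  set ξ := x - y
  -- the vector `q` is tangent, and `ξ - q` is a small multiple of `w`
  set q := ξ - e ξ • w with hq
  have hqP : q ∈ P := by
    rw [hker]
    simp [hq, hw]
  have h3 : ξ - P.starProjection ξ = Pᗮ.starProjection (ξ - q) := by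
    rw [Submodule.starProjection_orthogonal']
    simp only [sub_apply, one_apply_eq_self,
      map_sub, Submodule.starProjection_eq_self_iff.mpr hqP]
    abel
  rw [h3]
  calc ‖Pᗮ.starProjection (ξ - q)‖ ≤ ‖ξ - q‖ := Pᗮ.norm_starProjection_apply_le _
    _ = ‖e ξ‖ * ‖w‖ := by rw [hq, sub_sub_cancel, norm_smul]
    _ ≤ c / (‖w‖ + 1) * ‖ξ‖ * (‖w‖ + 1) := by gcongr; linarith
    _ = c * ‖ξ‖ := by field_simp

theorem trace_compression_eq (P : Submodule ℝ E) (L : E →L[ℝ] E) :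
    LinearMap.trace ℝ P (compression P L)
      = LinearMap.trace ℝ E ((P.starProjection ∘L L : E →L[ℝ] E) : E →ₗ[ℝ] E) := by
  have h := LinearMap.trace_comp_comm' (R := ℝ)
    ((P.orthogonalProjectionOnto ∘L L : E →L[ℝ] P) : E →ₗ[ℝ] P) P.subtype
  exact h.symm

/-- The trace of the compression to a hyperplane in terms of a normal vector; in this form it depends
continuously on the hyperplane. -/
theorem trace_compression_ker (e : E →L[ℝ] ℝ) (L : E →L[ℝ] E) :
    let g := (InnerProductSpace.toDual ℝ E).symm e
    LinearMap.trace ℝ _ (compression (LinearMap.ker (e : E →ₗ[ℝ] ℝ)) L).toLinearMap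
      = LinearMap.trace ℝ E (L : E →ₗ[ℝ] E) - (‖g‖ ^ 2)⁻¹ * e (L g) := by
  intro g
  have heg : ∀ x, inner ℝ g x = e x := fun x => by simp [g]
  have hker : LinearMap.ker (e : E →ₗ[ℝ] ℝ) = (ℝ ∙ g)ᗮ := by
    ext x
    rw [Submodule.mem_orthogonal_singleton_iff_inner_right, heg]
    rfl
  have hproj : ((LinearMap.ker (e : E →ₗ[ℝ] ℝ)).starProjection ∘L L : E →L[ℝ] E)
      = L - (‖g‖ ^ 2)⁻¹ • InnerProductSpace.rankOne ℝ g (L.adjoint g) := by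
    ext1 x
    simp only [hker, ContinuousLinearMap.comp_apply, Submodule.starProjection_orthogonal_val,
      Submodule.starProjection_singleton, sub_apply,
      smul_apply, InnerProductSpace.rankOne_apply,
      ContinuousLinearMap.adjoint_inner_left, smul_smul]
    congr 2
    simp [div_eq_inv_mul]
  rw [trace_compression_eq, hproj, ContinuousLinearMap.toLinearMap_sub, map_sub,
    ContinuousLinearMap.toLinearMap_smul, map_smul, InnerProductSpace.trace_rankOne,
    ContinuousLinearMap.adjoint_inner_left, heg, smul_eq_mul]

variable [MeasurableSpace E] [BorelSpace E]

theorem IsHypersurface.measure_lt_top {S : Set E} (hS : IsHypersurface 1 S) {K : Set E}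
    (hK : IsCompact K) (hKS : K ⊆ S) : μHE[finrank ℝ E - 1] K < ∞ := by
  refine hK.measure_lt_top_of_nhdsWithin fun p hp => ?_
  have hpS := hKS hp
  obtain ⟨r, hr, hball⟩ := hS.exists_ball_norm_sub_projection_le hpS (show (0 : ℝ) < 1 / 2 by simp)
  have hrank := hS.finrank_tangentSpace_add_one hpS
  set P := tangentSpace S p
  have hd : finrank ℝ E - 1 = finrank ℝ P := by omega
  refine ⟨K ∩ Metric.ball p r, inter_mem self_mem_nhdsWithin
    (nhdsWithin_le_nhds (Metric.ball_mem_nhds p hr)), ?_⟩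
  have h1 := euclideanHausdorffMeasure_le_projection P (finrank ℝ E - 1) zero_le_one
    (B := K ∩ Metric.ball p r) fun x hx y hy => by
      have h2 := hball x ⟨hKS hx.1, hx.2⟩ y ⟨hKS hy.1, hy.2⟩
      have h3 : ‖x - y‖ ≤ ‖(x - y) - P.starProjection (x - y)‖ + ‖P.starProjection (x - y)‖ := by
        simpa using norm_add_le ((x - y) - P.starProjection (x - y)) (P.starProjection (x - y))
      have h4 : ‖P.starProjection (x - y)‖ = ‖P.orthogonalProjectionOnto (x - y)‖ := rfl
      linarith
  refine h1.trans_lt (ENNReal.mul_lt_top (by simp) ?_)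
  rw [hd]
  have hbdd : Bornology.IsBounded (P.orthogonalProjectionOnto '' (K ∩ Metric.ball p r)) :=
    P.orthogonalProjectionOnto.lipschitz.isBounded_image
      (Metric.isBounded_ball.subset inter_subset_right)
  exact hbdd.measure_lt_top

end Euclidean

/-! ### Surface divergence -/

variable {n : ℕ}

theorem surfaceDiv_eq_trace {S : Set (EuclideanSpace ℝ (Fin n))}
    {u : EuclideanSpace ℝ (Fin n) → EuclideanSpace ℝ (Fin n)} {x : EuclideanSpace ℝ (Fin n)}
    {L : EuclideanSpace ℝ (Fin n) →L[ℝ] EuclideanSpace ℝ (Fin n)}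
    (hu : HasFDerivWithinAt u L S x) :
    surfaceDiv S u x = LinearMap.trace ℝ _ (compression (tangentSpace S x) L).toLinearMap := by
  have h1 : ∀ τ ∈ tangentSpace S x, fderivWithin ℝ u S x τ = L τ :=
    LinearMap.eqOn_span (f := (fderivWithin ℝ u S x).toLinearMap) (g := L.toLinearMap)
      (hu.differentiableWithinAt.hasFDerivWithinAt.unique_on hu)
  rw [LinearMap.trace_eq_sum_inner _ (stdOrthonormalBasis ℝ (tangentSpace S x)), surfaceDiv]
  refine Finset.sum_congr rfl fun i _ => ?_
  rw [h1 _ (Subtype.coe_prop _), real_inner_comm]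
  simp [compression]

/-- The surface divergence is computed by any local `C¹`-extension of the vector field. -/
theorem eventually_surfaceDiv_eq {S : Set (EuclideanSpace ℝ (Fin n))}
    {u u' : EuclideanSpace ℝ (Fin n) → EuclideanSpace ℝ (Fin n)} {p : EuclideanSpace ℝ (Fin n)}
    (hu' : ContDiffAt ℝ 1 u' p) (huu' : ∀ᶠ x in 𝓝[S] p, u x = u' x) :
    ∀ᶠ x in 𝓝[S] p, surfaceDiv S u x
      = LinearMap.trace ℝ _ (compression (tangentSpace S x) (fderiv ℝ u' x)).toLinearMap := by
  have h1 : ∀ᶠ x in 𝓝 p, ContDiffAt ℝ 1 u' x := hu'.eventually (by simp)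
  filter_upwards [nhdsWithin_le_nhds h1, eventually_eventually_nhdsWithin.mpr huu',
    self_mem_nhdsWithin] with x hx1 hx2 hxS
  refine surfaceDiv_eq_trace ?_
  exact (hx1.differentiableAt one_ne_zero).hasFDerivAt.hasFDerivWithinAt.congr_of_eventuallyEq hx2
    (hx2.self_of_nhdsWithin hxS)

theorem IsHypersurface.continuousWithinAt_surfaceDiv {S : Set (EuclideanSpace ℝ (Fin n))}
    (hS : IsHypersurface 1 S)
    {u u' : EuclideanSpace ℝ (Fin n) → EuclideanSpace ℝ (Fin n)} {p : EuclideanSpace ℝ (Fin n)}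
    (hp : p ∈ S) (hu' : ContDiffAt ℝ 1 u' p) (huu' : ∀ᶠ x in 𝓝[S] p, u x = u' x) :
    ContinuousWithinAt (surfaceDiv S u) S p := by
  obtain ⟨U, hU, hpU, f, hf, hf', hSU⟩ := hS p hp
  have hf0 : ∀ x ∈ S, x ∈ U → f x = 0 := fun x hx hxU =>
    (hSU ▸ (⟨hx, hxU⟩ : x ∈ S ∩ U) : x ∈ {x ∈ U | f x = 0}).2
  set g := fun x => (InnerProductSpace.toDual ℝ (EuclideanSpace ℝ (Fin n))).symm (fderiv ℝ f x)
    with hg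
  have heq : ∀ᶠ x in 𝓝[S] p, surfaceDiv S u x
      = LinearMap.trace ℝ _ (fderiv ℝ u' x).toLinearMap
        - (‖g x‖ ^ 2)⁻¹ * fderiv ℝ f x (fderiv ℝ u' x (g x)) := by
    filter_upwards [eventually_surfaceDiv_eq hu' huu', nhdsWithin_le_nhds (hU.mem_nhds hpU),
      self_mem_nhdsWithin] with x h1 hxU hxS
    rw [h1, tangentSpace_eq_ker hU hxU hf (hf' x hxU) (hf0 x hxS hxU) hSU]
    exact trace_compression_ker _ _
  refine ContinuousWithinAt.congr_of_eventuallyEq ?_ heq (heq.self_of_nhdsWithin hp)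
  refine ContinuousAt.continuousWithinAt ?_
  have hfc : ContinuousAt (fderiv ℝ f) p :=
    (hf.contDiffAt (hU.mem_nhds hpU)).continuousAt_fderiv one_ne_zero
  have huc : ContinuousAt (fderiv ℝ u') p := hu'.continuousAt_fderiv one_ne_zero
  have hgc : ContinuousAt g p :=
    (InnerProductSpace.toDual ℝ (EuclideanSpace ℝ (Fin n))).symm.continuous.continuousAt.comp hfc
  let T : (EuclideanSpace ℝ (Fin n) →L[ℝ] EuclideanSpace ℝ (Fin n)) →ₗ[ℝ] ℝ :=
    LinearMap.trace ℝ (EuclideanSpace ℝ (Fin n)) ∘ₗ ContinuousLinearMap.coeLM ℝ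
  have htr : Continuous T := T.continuous_of_finiteDimensional
  have hg0 : ‖g p‖ ^ 2 ≠ 0 := by
    simpa [hg] using hf' p hpU
  exact (htr.continuousAt.comp huc).sub (((hgc.norm.pow 2).inv₀ hg0).mul
    (hfc.clm_apply (huc.clm_apply hgc)))

/-! ### Trajectories on the moving surface -/

/-- A curve starting within `r` of `x₀` whose speed is at most `M` as long as it is within `ρ` of
`x₀` stays within `ρ` of `x₀` for the time `(ρ - r) / (M + 1)`, forward in time. -/
theorem norm_sub_le_of_speed_le_of_le {E : Type*} [NormedAddCommGroup E] [NormedSpace ℝ E]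
    {γ w : ℝ → E} {x₀ : E} {a b r ρ M : ℝ} (hab : a ≤ b)
    (hγ : ∀ s ∈ Icc a b, HasDerivAt γ (w s) s) (ha : ‖γ a - x₀‖ ≤ r) (hM : 0 ≤ M)
    (hw : ∀ s ∈ Icc a b, ‖γ s - x₀‖ ≤ ρ → ‖w s‖ ≤ M) (hρ : r + (M + 1) * (b - a) ≤ ρ) :
    ‖γ b - x₀‖ ≤ ρ := by
  have h := image_norm_le_of_norm_deriv_right_lt_deriv_boundary (f := fun s => γ s - x₀) (f' := w)
    (a := a) (b := b) (B := fun s => r + (M + 1) * (s - a)) (B' := fun _ => M + 1)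
    (fun s hs => ((hγ s hs).sub_const x₀).continuousAt.continuousWithinAt)
    (fun s hs => ((hγ s (Ico_subset_Icc_self hs)).sub_const x₀).hasDerivWithinAt)
    (by simpa using ha)
    (fun s => by simpa using (((hasDerivAt_id s).sub_const a).const_mul (M + 1)).const_add r)
    (fun s hs heq => by
      refine (hw s (Ico_subset_Icc_self hs) ?_).trans_lt (lt_add_one M)
      refine heq.le.trans (le_trans ?_ hρ)
      have : (M + 1) * (s - a) ≤ (M + 1) * (b - a) := by gcongr; exact hs.2.le
      linarith)
  exact (h (right_mem_Icc.mpr hab)).trans hρ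

/-- `norm_sub_le_of_speed_le_of_le` in both directions of time. -/
theorem norm_sub_le_of_speed_le {E : Type*} [NormedAddCommGroup E] [NormedSpace ℝ E]
    {γ w : ℝ → E} {x₀ : E} {a b r ρ M : ℝ}
    (hγ : ∀ s ∈ uIcc a b, HasDerivAt γ (w s) s) (ha : ‖γ a - x₀‖ ≤ r) (hM : 0 ≤ M)
    (hw : ∀ s ∈ uIcc a b, ‖γ s - x₀‖ ≤ ρ → ‖w s‖ ≤ M) (hρ : r + (M + 1) * |b - a| ≤ ρ) :
    ‖γ b - x₀‖ ≤ ρ := by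
  rcases le_total a b with hab | hab
  · rw [uIcc_of_le hab] at hγ hw
    rw [abs_of_nonneg (sub_nonneg.mpr hab)] at hρ
    exact norm_sub_le_of_speed_le_of_le hab hγ ha hM hw hρ
  · rw [uIcc_of_ge hab] at hγ hw
    rw [abs_of_nonpos (sub_nonpos.mpr hab)] at hρ
    have h := norm_sub_le_of_speed_le_of_le (γ := fun s => γ (-s)) (w := fun s => -w (-s))
      (neg_le_neg hab) (x₀ := x₀) (r := r) (ρ := ρ)
      (fun s hs => by
        have hs' : -s ∈ Icc b a := ⟨by linarith [hs.2], by linarith [hs.1]⟩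
        have h := (hγ _ hs').scomp s (hasDerivAt_neg s)
        rw [neg_one_smul] at h
        exact h)
      (by simpa using ha) hM
      (fun s hs h => by
        rw [norm_neg]
        exact hw (-s) ⟨by linarith [hs.2], by linarith [hs.1]⟩ h)
      (by linarith)
    simpa using h

section Trajectory

variable {n : ℕ} {J : Set ℝ} {S : ℝ → Set (EuclideanSpace ℝ (Fin n))}
  {v : ℝ × EuclideanSpace ℝ (Fin n) → EuclideanSpace ℝ (Fin n)}
  {γ η : ℝ → EuclideanSpace ℝ (Fin n)}

theorem IsSurfaceTrajectory.mem_graph (hγ : IsSurfaceTrajectory J S v γ) {s : ℝ} (hs : s ∈ J) :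
    (s, γ s) ∈ graph J S := ⟨hs, (hγ s hs).1⟩

theorem IsSurfaceTrajectory.hasDerivAt_graph (hγ : IsSurfaceTrajectory J S v γ) {s : ℝ}
    (hs : s ∈ J) : HasDerivAt (fun r => (r, γ r)) ((1 : ℝ), v (s, γ s)) s :=
  (hasDerivAt_id s).prodMk (hγ s hs).2

/-- Trajectories near a point of the graph at some time stay near it for a short time. -/
theorem exists_trajectory_mem_ball (hJ : IsOpen J) {s₀ : ℝ} {x₀ : EuclideanSpace ℝ (Fin n)}
    (hp : (s₀, x₀) ∈ graph J S) (hv : ContinuousWithinAt v (graph J S) (s₀, x₀)) {R : ℝ}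
    (hR : 0 < R) :
    ∃ r > 0, ∃ δ > 0, Metric.ball s₀ δ ⊆ J ∧ ∀ γ, IsSurfaceTrajectory J S v γ →
      ∀ s₁ ∈ Metric.ball s₀ δ, γ s₁ ∈ Metric.ball x₀ r → ∀ s₂ ∈ Metric.ball s₀ δ,
        (s₂, γ s₂) ∈ graph J S ∩ Metric.ball (s₀, x₀) R := by
  set M := ‖v (s₀, x₀)‖ + 1 with hM
  have hM0 : 0 ≤ M := by positivity
  have hbound : ∀ᶠ p in 𝓝[graph J S] (s₀, x₀), ‖v p‖ ≤ M :=
    hv.norm.eventually (ge_mem_nhds (lt_add_one _))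
  obtain ⟨R₁, hR₁, hball⟩ := Metric.mem_nhdsWithin_iff.mp hbound
  obtain ⟨δ₁, hδ₁, hδJ⟩ := Metric.isOpen_iff.mp hJ s₀ hp.1
  set R' := min R R₁ with hR'
  have hR'0 : 0 < R' := lt_min hR hR₁
  set δ := min δ₁ (min (R' / 2) (R' / (8 * (M + 1)))) with hδ
  have hδJ' : Metric.ball s₀ δ ⊆ J := (Metric.ball_subset_ball (min_le_left _ _)).trans hδJ
  refine ⟨R' / 4, by positivity, δ, by positivity, hδJ', ?_⟩
  intro γ hγ s₁ hs₁ hγs₁ s₂ hs₂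
  have hsub : uIcc s₁ s₂ ⊆ Metric.ball s₀ δ := by
    rw [← segment_eq_uIcc]
    exact (convex_ball s₀ δ).segment_subset hs₁ hs₂
  have hmem : ∀ s ∈ Metric.ball s₀ δ, ‖γ s - x₀‖ ≤ R' / 2 →
      (s, γ s) ∈ graph J S ∩ Metric.ball (s₀, x₀) R' := by
    intro s hs h
    refine ⟨hγ.mem_graph (hδJ' hs), ?_⟩
    rw [← ball_prod_same]
    refine ⟨?_, ?_⟩
    · refine Metric.ball_subset_ball ?_ hs
      exact ((min_le_right _ _).trans (min_le_left _ _)).trans (by linarith)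
    · rw [Metric.mem_ball, dist_eq_norm]
      linarith
  have hdist : |s₂ - s₁| ≤ R' / (8 * (M + 1)) + R' / (8 * (M + 1)) := by
    have h1 : δ ≤ R' / (8 * (M + 1)) := (min_le_right _ _).trans (min_le_right _ _)
    have h2 := dist_triangle_right s₂ s₁ s₀
    rw [Real.dist_eq s₂ s₁] at h2
    linarith [Metric.mem_ball.mp hs₁, Metric.mem_ball.mp hs₂]
  have h := norm_sub_le_of_speed_le (γ := γ) (w := fun s => v (s, γ s)) (x₀ := x₀) (a := s₁)
    (b := s₂) (r := R' / 4) (ρ := R' / 2) (M := M) (fun s hs => (hγ s (hδJ' (hsub hs))).2)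
    (by rw [← dist_eq_norm]; exact (Metric.mem_ball.mp hγs₁).le) hM0
    (fun s hs h => by
      have h1 := hmem s (hsub hs) h
      exact hball ⟨Metric.ball_subset_ball (min_le_right _ _) h1.2, h1.1⟩)
    (by
      calc R' / 4 + (M + 1) * |s₂ - s₁|
          ≤ R' / 4 + (M + 1) * (R' / (8 * (M + 1)) + R' / (8 * (M + 1))) := by gcongr
        _ = R' / 2 := by field_simp; norm_num)
  have h1 := hmem s₂ hs₂ h
  exact ⟨h1.1, Metric.ball_subset_ball (min_le_left _ _) h1.2⟩

/-- Near a point of the graph, the difference of two trajectories at most doubles in a short time,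
and it solves the linearized equation up to a small error. -/
theorem exists_trajectory_sub_le (hJ : IsOpen J) {s₀ : ℝ} {x₀ : EuclideanSpace ℝ (Fin n)}
    (hp : (s₀, x₀) ∈ graph J S)
    {v' : ℝ × EuclideanSpace ℝ (Fin n) → EuclideanSpace ℝ (Fin n)}
    (hv' : ContDiffAt ℝ 1 v' (s₀, x₀)) (hvv' : ∀ᶠ p in 𝓝[graph J S] (s₀, x₀), v p = v' p) {c : ℝ}
    (hc : 0 < c) :
    ∃ r > 0, ∃ δ > 0, Metric.ball s₀ δ ⊆ J ∧
      ∀ γ, IsSurfaceTrajectory J S v γ → ∀ η, IsSurfaceTrajectory J S v η →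
      ∀ s₁ ∈ Metric.ball s₀ δ, γ s₁ ∈ Metric.ball x₀ r → η s₁ ∈ Metric.ball x₀ r →
      ∀ s₂ ∈ Metric.ball s₀ δ, ‖γ s₂ - η s₂‖ ≤ 2 * ‖γ s₁ - η s₁‖ ∧
        ‖v (s₂, γ s₂) - v (s₂, η s₂) - fderiv ℝ v' (s₀, x₀) (0, γ s₂ - η s₂)‖
          ≤ c * ‖γ s₂ - η s₂‖ := by
  have hvc : ContinuousWithinAt v (graph J S) (s₀, x₀) :=
    hv'.continuousAt.continuousWithinAt.congr_of_eventuallyEq hvv' (hvv'.self_of_nhdsWithin hp)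
  set L := fderiv ℝ v' (s₀, x₀) with hL
  have hstrict := (hv'.hasStrictFDerivAt one_ne_zero).isLittleO.def hc
  obtain ⟨R₁, hR₁, hball₁⟩ := Metric.eventually_nhds_iff_ball.mp hstrict
  obtain ⟨R₂, hR₂, hball₂⟩ := Metric.mem_nhdsWithin_iff.mp hvv'
  obtain ⟨r, hr, δ₁, hδ₁, hδJ, hstay⟩ :=
    exists_trajectory_mem_ball hJ hp hvc (lt_min hR₁ hR₂)
  set K := ‖L‖ + c with hK
  have hK0 : 0 < K := by positivity
  set δ := min δ₁ (1 / (4 * K)) with hδ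
  have hδδ₁ : Metric.ball s₀ δ ⊆ Metric.ball s₀ δ₁ := Metric.ball_subset_ball (min_le_left _ _)
  refine ⟨r, hr, δ, by positivity, hδδ₁.trans hδJ, ?_⟩
  intro γ hγ η hη s₁ hs₁ hγs₁ hηs₁
  have hlin : ∀ s ∈ Metric.ball s₀ δ,
      ‖v (s, γ s) - v (s, η s) - L (0, γ s - η s)‖ ≤ c * ‖γ s - η s‖ := by
    intro s hs
    obtain ⟨h1, h2⟩ := hstay γ hγ s₁ (hδδ₁ hs₁) hγs₁ s (hδδ₁ hs)
    obtain ⟨h3, h4⟩ := hstay η hη s₁ (hδδ₁ hs₁) hηs₁ s (hδδ₁ hs)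
    have e1 : v (s, γ s) = v' (s, γ s) :=
      hball₂ ⟨Metric.ball_subset_ball (min_le_right _ _) h2, h1⟩
    have e2 : v (s, η s) = v' (s, η s) :=
      hball₂ ⟨Metric.ball_subset_ball (min_le_right _ _) h4, h3⟩
    have h5 := hball₁ ((s, γ s), (s, η s)) (by
      rw [← ball_prod_same]
      exact ⟨Metric.ball_subset_ball (min_le_left _ _) h2,
        Metric.ball_subset_ball (min_le_left _ _) h4⟩)
    have e3 : ((s, γ s) : ℝ × EuclideanSpace ℝ (Fin n)) - (s, η s) = (0, γ s - η s) := by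
      simp
    have e4 : ‖((0, γ s - η s) : ℝ × EuclideanSpace ℝ (Fin n))‖ = ‖γ s - η s‖ := by
      simp [Prod.norm_def]
    rw [e1, e2]
    simpa only [e3, e4] using h5
  refine fun s₂ hs₂ => ⟨?_, hlin s₂ hs₂⟩
  have hderiv : ∀ s ∈ Metric.ball s₀ δ,
      HasDerivAt (fun s => γ s - η s) (v (s, γ s) - v (s, η s)) s := fun s hs =>
    (hγ s (hδJ (hδδ₁ hs))).2.sub (hη s (hδJ (hδδ₁ hs))).2
  have hsub : uIcc s₁ s₂ ⊆ Metric.ball s₀ δ := by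
    rw [← segment_eq_uIcc]
    exact (convex_ball s₀ δ).segment_subset hs₁ hs₂
  -- at a maximum point `s` of the distance on the time interval, the mean value inequality gives
  -- `m ≤ ‖γ s₁ - η s₁‖ + m / 2` for the maximum `m`
  obtain ⟨s, hs, hmax⟩ := isCompact_uIcc.exists_isMaxOn (nonempty_uIcc (a := s₁) (b := s₂))
    (f := fun s => ‖γ s - η s‖)
    (fun s hs => (hderiv s (hsub hs)).continuousAt.norm.continuousWithinAt)
  set m := ‖γ s - η s‖ with hm
  have hle : ∀ u ∈ uIcc s₁ s₂, ‖γ u - η u‖ ≤ m := fun u hu => hmax hu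
  have hmv := (convex_uIcc s₁ s₂).norm_image_sub_le_of_norm_hasDerivWithin_le (C := K * m)
    (fun u hu => (hderiv u (hsub hu)).hasDerivWithinAt)
    (fun u hu => by
      have h1 := hlin u (hsub hu)
      have h2 : ‖L (0, γ u - η u)‖ ≤ ‖L‖ * ‖γ u - η u‖ := by
        refine (L.le_opNorm _).trans_eq ?_
        simp [Prod.norm_def]
      have h3 := norm_sub_norm_le (v (u, γ u) - v (u, η u)) (L (0, γ u - η u))
      calc ‖v (u, γ u) - v (u, η u)‖ ≤ K * ‖γ u - η u‖ := by rw [hK]; linarith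
        _ ≤ K * m := by gcongr; exact hle u hu)
    left_mem_uIcc hs
  have hdist : ‖s - s₁‖ ≤ 1 / (4 * K) + 1 / (4 * K) := by
    have h1 : δ ≤ 1 / (4 * K) := min_le_right _ _
    have h2 := dist_triangle_right s s₁ s₀
    rw [dist_eq_norm s s₁] at h2
    linarith [Metric.mem_ball.mp hs₁, Metric.mem_ball.mp (hsub hs)]
  have h1 : K * m * ‖s - s₁‖ ≤ m / 2 := by
    calc K * m * ‖s - s₁‖ ≤ K * m * (1 / (4 * K) + 1 / (4 * K)) := by gcongr
      _ = m / 2 := by field_simp; ring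
  have h2 := norm_sub_norm_le (γ s - η s) (γ s₁ - η s₁)
  have h3 := hle s₂ right_mem_uIcc
  linarith

/-- **First order expansion of the flow in the Lipschitz sense.** With `L` close to the spatial
derivative of `v` at a point of the graph, the flow from time `t` to time `s` differs from
`x ↦ x + (s - t) v (t, x)`, hence from `1 + (s - t) L`, by a map with a Lipschitz constant
`ε |s - t|`. -/
theorem exists_flow_near_linear (hJ : IsOpen J) {t : ℝ} {x₀ : EuclideanSpace ℝ (Fin n)}
    (hp : (t, x₀) ∈ graph J S)
    {v' : ℝ × EuclideanSpace ℝ (Fin n) → EuclideanSpace ℝ (Fin n)}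
    (hv' : ContDiffAt ℝ 1 v' (t, x₀)) (hvv' : ∀ᶠ p in 𝓝[graph J S] (t, x₀), v p = v' p) {ε : ℝ}
    (hε : 0 < ε) :
    ∃ r > 0, ∃ δ > 0, Metric.ball t δ ⊆ J ∧
      ∀ γ, IsSurfaceTrajectory J S v γ → ∀ η, IsSurfaceTrajectory J S v η →
      γ t ∈ Metric.ball x₀ r → η t ∈ Metric.ball x₀ r → ∀ s ∈ Metric.ball t δ,
      ∀ L : EuclideanSpace ℝ (Fin n) →L[ℝ] EuclideanSpace ℝ (Fin n),
      ‖L - (fderiv ℝ v' (t, x₀)).comp (ContinuousLinearMap.inr ℝ ℝ _)‖ ≤ ε / 4 →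
        ‖γ s - η s - (γ t - η t) - (s - t) • L (γ t - η t)‖ ≤ ε * |s - t| * ‖γ t - η t‖ := by
  obtain ⟨r, hr, δ₁, hδ₁, hδJ, hsub⟩ :=
    exists_trajectory_sub_le hJ hp hv' hvv' (c := ε / 8) (by positivity)
  set L₀ := (fderiv ℝ v' (t, x₀)).comp (ContinuousLinearMap.inr ℝ ℝ (EuclideanSpace ℝ (Fin n)))
    with hL₀
  have hL₀app : ∀ y, fderiv ℝ v' (t, x₀) (0, y) = L₀ y := fun y => rfl
  simp only [hL₀app] at hsub
  set K := ‖L₀‖ + ε / 8 with hK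
  have hK0 : 0 < K := by positivity
  set δ := min δ₁ (ε / (4 * (‖L₀‖ + 1) * (2 * K))) with hδ
  have hδ0 : 0 < δ := by positivity
  have hδδ₁ : Metric.ball t δ ⊆ Metric.ball t δ₁ := Metric.ball_subset_ball (min_le_left _ _)
  refine ⟨r, hr, δ, hδ0, hδδ₁.trans hδJ, ?_⟩
  intro γ hγ η hη hγt hηt s hs L hL
  have ht : t ∈ Metric.ball t δ := Metric.mem_ball_self hδ0
  have key := hsub γ hγ η hη t (hδδ₁ ht) hγt hηt
  set m := ‖γ t - η t‖ with hm
  have hm0 : 0 ≤ m := norm_nonneg _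
  have hderiv : ∀ u ∈ Metric.ball t δ,
      HasDerivAt (fun u => γ u - η u) (v (u, γ u) - v (u, η u)) u := fun u hu =>
    (hγ u (hδJ (hδδ₁ hu))).2.sub (hη u (hδJ (hδδ₁ hu))).2
  have hspeed : ∀ u ∈ Metric.ball t δ, ‖v (u, γ u) - v (u, η u)‖ ≤ K * (2 * m) := by
    intro u hu
    obtain ⟨h1, h2⟩ := key u (hδδ₁ hu)
    have h3 := norm_sub_norm_le (v (u, γ u) - v (u, η u)) (L₀ (γ u - η u))
    have h4 := L₀.le_opNorm (γ u - η u)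
    calc ‖v (u, γ u) - v (u, η u)‖ ≤ K * ‖γ u - η u‖ := by rw [hK]; linarith
      _ ≤ K * (2 * m) := by gcongr
  have hdiff : ∀ u ∈ Metric.ball t δ, ‖γ u - η u - (γ t - η t)‖ ≤ K * (2 * m) * δ := by
    intro u hu
    have h1 := (convex_ball t δ).norm_image_sub_le_of_norm_hasDerivWithin_le
      (fun u hu => (hderiv u hu).hasDerivWithinAt) hspeed ht hu
    refine h1.trans ?_
    rw [← dist_eq_norm]
    gcongr
    exact (Metric.mem_ball.mp hu).le
  have hmv := (convex_ball t δ).norm_image_sub_le_of_norm_hasDerivWithin_le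
    (f := fun u => γ u - η u - u • L (γ t - η t))
    (f' := fun u => v (u, γ u) - v (u, η u) - (1 : ℝ) • L (γ t - η t)) (C := ε * m)
    (fun u hu => ((hderiv u hu).sub ((hasDerivAt_id u).smul_const _)).hasDerivWithinAt)
    (fun u hu => by
      obtain ⟨h1, h2⟩ := key u (hδδ₁ hu)
      -- the three errors: linearization of `v`, growth of `γ - η`, and `L` against `L₀`
      have e : v (u, γ u) - v (u, η u) - (1 : ℝ) • L (γ t - η t)
          = (v (u, γ u) - v (u, η u) - L₀ (γ u - η u))
            + (L₀ (γ u - η u - (γ t - η t)) - (L - L₀) (γ t - η t)) := by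
        simp only [map_sub, one_smul, sub_apply]
        abel
      have h3 : ‖v (u, γ u) - v (u, η u) - L₀ (γ u - η u)‖ ≤ ε / 8 * (2 * m) :=
        h2.trans (by gcongr)
      have h4 : ‖L₀ (γ u - η u - (γ t - η t))‖ ≤ ε / 4 * m := by
        calc ‖L₀ (γ u - η u - (γ t - η t))‖ ≤ ‖L₀‖ * (K * (2 * m) * δ) :=
              (L₀.le_opNorm _).trans (by gcongr; exact hdiff u hu)
          _ ≤ (‖L₀‖ + 1) * (K * (2 * m) * (ε / (4 * (‖L₀‖ + 1) * (2 * K)))) := by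
              gcongr
              · linarith
              · exact min_le_right _ _
          _ = ε / 4 * m := by field_simp
      have h5 : ‖(L - L₀) (γ t - η t)‖ ≤ ε / 4 * m :=
        (L - L₀).le_of_opNorm_le hL _
      rw [e]
      refine (norm_add_le _ _).trans ?_
      have h6 := norm_sub_le (L₀ (γ u - η u - (γ t - η t))) ((L - L₀) (γ t - η t))
      have : 0 ≤ ε * m := by positivity
      linarith)
    ht hs
  have e : γ s - η s - (γ t - η t) - (s - t) • L (γ t - η t)
      = (γ s - η s - s • L (γ t - η t)) - (γ t - η t - t • L (γ t - η t)) := by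
    rw [sub_smul]; abel
  rw [e]
  refine hmv.trans_eq ?_
  rw [Real.norm_eq_abs]
  ring

/-! ### Uniqueness and continuous dependence of trajectories -/

/-- A property of times in `J` which propagates locally propagates over `J`. -/
theorem of_locally_propagating (hJ : J.OrdConnected) {Q : ℝ → Prop}
    (hQ : ∀ s₀ ∈ J, ∃ δ > 0, ∀ s₁ ∈ Metric.ball s₀ δ, ∀ s₂ ∈ Metric.ball s₀ δ, s₁ ∈ J → s₂ ∈ J →
      Q s₁ → Q s₂) {s t : ℝ} (hs : s ∈ J) (ht : t ∈ J) (h : Q s) : Q t := by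
  refine hJ.isPreconnected.induction₂' (fun a b => Q a → Q b) (fun x hx => ?_)
    (fun a b c _ _ _ hab hbc h => hbc (hab h)) hs ht h
  obtain ⟨δ, hδ, hprop⟩ := hQ x hx
  filter_upwards [self_mem_nhdsWithin, nhdsWithin_le_nhds (Metric.ball_mem_nhds x hδ)] with y hyJ hy
  exact ⟨hprop x (Metric.mem_ball_self hδ) y hy hx hyJ,
    hprop y hy x (Metric.mem_ball_self hδ) hyJ hx⟩

theorem IsSurfaceTrajectory.eq_of_eq (hJ : IsOpen J) (hJc : J.OrdConnected)
    (hG : IsHypersurface 1 (graph J S)) (hv : ContDiffOn ℝ 1 v (graph J S))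
    (hγ : IsSurfaceTrajectory J S v γ)
    (hη : IsSurfaceTrajectory J S v η) {s t : ℝ} (hs : s ∈ J) (ht : t ∈ J) (h : γ s = η s) :
    γ t = η t := by
  refine of_locally_propagating hJc (Q := fun s => γ s = η s) (fun s₀ hs₀ => ?_) hs ht h
  obtain ⟨v', hv', hvv'⟩ := hG.exists_contDiffAt_extension (hγ.mem_graph hs₀) hv
  obtain ⟨r, hr, δ, hδ, -, hsub⟩ :=
    exists_trajectory_sub_le hJ (hγ.mem_graph hs₀) hv' hvv' one_pos
  obtain ⟨δ', hδ', hball⟩ := Metric.continuousAt_iff.mp (hγ s₀ hs₀).2.continuousAt r hr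
  refine ⟨min δ δ', by positivity, fun s₁ hs₁ s₂ hs₂ _ _ hQ => ?_⟩
  have h1 : γ s₁ ∈ Metric.ball (γ s₀) r :=
    hball (Metric.ball_subset_ball (min_le_right _ _) hs₁)
  have h2 := (hsub γ hγ η hη s₁ (Metric.ball_subset_ball (min_le_left _ _) hs₁) h1
    (hQ ▸ h1) s₂ (Metric.ball_subset_ball (min_le_left _ _) hs₂)).1
  rw [hQ, sub_self, norm_zero, mul_zero] at h2
  exact sub_eq_zero.mp (norm_le_zero_iff.mp h2)

/-- Trajectories depend continuously on their initial values, over the whole time interval. -/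
theorem continuousOn_trajectory (hJ : IsOpen J) (hJc : J.OrdConnected)
    (hG : IsHypersurface 1 (graph J S)) (hv : ContDiffOn ℝ 1 v (graph J S))
    {B : Set (EuclideanSpace ℝ (Fin n))}
    {Γ : EuclideanSpace ℝ (Fin n) → ℝ → EuclideanSpace ℝ (Fin n)} {s t : ℝ} (hs : s ∈ J)
    (ht : t ∈ J) (hΓ : ∀ x ∈ B, IsSurfaceTrajectory J S v (Γ x) ∧ Γ x s = x) :
    ContinuousOn (fun x => Γ x t) B := by
  intro x hx
  have hγ := (hΓ x hx).1
  refine of_locally_propagating hJc (Q := fun s => ContinuousWithinAt (fun y => Γ y s) B x)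
    (fun s₀ hs₀ => ?_) hs ht ?_
  · obtain ⟨v', hv', hvv'⟩ := hG.exists_contDiffAt_extension (hγ.mem_graph hs₀) hv
    obtain ⟨r, hr, δ, hδ, -, hsub⟩ :=
      exists_trajectory_sub_le hJ (hγ.mem_graph hs₀) hv' hvv' one_pos
    obtain ⟨δ', hδ', hball⟩ := Metric.continuousAt_iff.mp (hγ s₀ hs₀).2.continuousAt r hr
    refine ⟨min δ δ', by positivity, fun s₁ hs₁ s₂ hs₂ _ _ hQ => ?_⟩
    have h1 : Γ x s₁ ∈ Metric.ball (Γ x s₀) r :=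
      hball (Metric.ball_subset_ball (min_le_right _ _) hs₁)
    have h2 : ∀ᶠ y in 𝓝[B] x, Γ y s₁ ∈ Metric.ball (Γ x s₀) r :=
      hQ.eventually (Metric.isOpen_ball.mem_nhds h1)
    have h3 : Tendsto (fun y => 2 * ‖Γ y s₁ - Γ x s₁‖) (𝓝[B] x) (𝓝 0) := by
      have h4 : Tendsto (fun y => Γ y s₁) (𝓝[B] x) (𝓝 (Γ x s₁)) := hQ
      simpa using ((h4.sub_const (Γ x s₁)).norm).const_mul 2
    refine tendsto_iff_norm_sub_tendsto_zero.mpr (squeeze_zero' (Eventually.of_forall fun y =>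
      norm_nonneg _) ?_ h3)
    filter_upwards [h2, self_mem_nhdsWithin] with y hy hyB
    exact (hsub _ (hΓ y hyB).1 _ hγ s₁ (Metric.ball_subset_ball (min_le_left _ _) hs₁) hy h1 s₂
      (Metric.ball_subset_ball (min_le_left _ _) hs₂)).1
  · exact continuousWithinAt_id.congr (fun y hy => (hΓ y hy).2) (hΓ x hx).2

/-- The flow maps of a co-moving family of areas, with any `t ∈ J` as initial time. -/
theorem IsCoMovingAreaFamily.exists_flow (hJ : IsOpen J) (hJc : J.OrdConnected)
    (hG : IsHypersurface 1 (graph J S)) (hv : ContDiffOn ℝ 1 v (graph J S))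
    {A : ℝ → Set (EuclideanSpace ℝ (Fin n))}
    (hA : IsCoMovingAreaFamily J S v A) {t : ℝ} (ht : t ∈ J) :
    IsCompact (A t) ∧ A t ⊆ S t ∧ ∃ Φ : ℝ → EuclideanSpace ℝ (Fin n) → EuclideanSpace ℝ (Fin n),
      (∀ x ∈ A t, IsSurfaceTrajectory J S v (fun s => Φ s x) ∧ Φ t x = x) ∧
      ∀ s ∈ J, ContinuousOn (Φ s) (A t) ∧ InjOn (Φ s) (A t) ∧ Φ s '' A t = A s := by
  obtain ⟨t₀, ht₀, ⟨-, hcomp, -⟩, hex, hflow⟩ := hA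
  choose! Γ hΓ hΓ₀ using hex
  have himage : A t = (fun x => Γ x t) '' A t₀ := by
    rw [hflow t ht]
    ext y
    constructor
    · rintro ⟨γ, hγ, hγ₀, rfl⟩
      exact ⟨γ t₀, hγ₀, (hΓ _ hγ₀).eq_of_eq hJ hJc hG hv hγ ht₀ ht (hΓ₀ _ hγ₀)⟩
    · rintro ⟨x, hx, rfl⟩
      exact ⟨Γ x, hΓ x hx, by rwa [hΓ₀ x hx], rfl⟩
  have hcompt : IsCompact (A t) := by
    rw [himage]
    exact hcomp.image_of_continuousOn
      (continuousOn_trajectory hJ hJc hG hv ht₀ ht fun x hx => ⟨hΓ x hx, hΓ₀ x hx⟩)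
  have hex' : ∀ x ∈ A t, ∃ γ, IsSurfaceTrajectory J S v γ ∧ γ t₀ ∈ A t₀ ∧ γ t = x := by
    intro x hx
    rwa [hflow t ht] at hx
  choose! Δ hΔ hΔ₀ hΔt using hex'
  refine ⟨hcompt, fun x hx => hΔt x hx ▸ (hΔ x hx t ht).1, fun s x => Δ x s,
    fun x hx => ⟨hΔ x hx, hΔt x hx⟩, fun s hs => ⟨?_, ?_, ?_⟩⟩
  · exact continuousOn_trajectory hJ hJc hG hv ht hs fun x hx => ⟨hΔ x hx, hΔt x hx⟩
  · intro x hx y hy hxy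
    have := (hΔ x hx).eq_of_eq hJ hJc hG hv (hΔ y hy) hs ht hxy
    rwa [hΔt x hx, hΔt y hy] at this
  · rw [hflow s hs]
    ext y
    constructor
    · rintro ⟨x, hx, rfl⟩
      exact ⟨Δ x, hΔ x hx, hΔ₀ x hx, rfl⟩
    · rintro ⟨γ, hγ, hγ₀, rfl⟩
      have hx : γ t ∈ A t := by
        rw [hflow t ht]
        exact ⟨γ, hγ, hγ₀, rfl⟩
      exact ⟨γ t, hx, (hΔ _ hx).eq_of_eq hJ hJc hG hv hγ ht hs (hΔt _ hx)⟩

end Trajectory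

/-! ### The material derivative -/

section Material

variable {n : ℕ} {J : Set ℝ} {S : ℝ → Set (EuclideanSpace ℝ (Fin n))}
  {v : ℝ × EuclideanSpace ℝ (Fin n) → EuclideanSpace ℝ (Fin n)}
  {γ : ℝ → EuclideanSpace ℝ (Fin n)}
  {φ φ' : ℝ × EuclideanSpace ℝ (Fin n) → ℝ}

theorem IsSurfaceTrajectory.hasDerivAt_comp (hJ : IsOpen J) (hγ : IsSurfaceTrajectory J S v γ)
    {s : ℝ} (hs : s ∈ J) (hφ : DifferentiableWithinAt ℝ φ (graph J S) (s, γ s)) :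
    HasDerivAt (fun r => φ (r, γ r)) (surfaceMaterialDeriv J S v φ (s, γ s)) s := by
  refine hφ.hasFDerivWithinAt.comp_hasDerivAt s (hγ.hasDerivAt_graph hs) ?_
  filter_upwards [hJ.mem_nhds hs] with r hr using hγ.mem_graph hr

/-- The material derivative is computed by local extensions of `φ`: both are the derivative of
`φ` along a trajectory. -/
theorem IsSurfaceTrajectory.surfaceMaterialDeriv_eq (hJ : IsOpen J)
    (hγ : IsSurfaceTrajectory J S v γ) {s : ℝ} (hs : s ∈ J) {p : ℝ × EuclideanSpace ℝ (Fin n)}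
    (hp : p = (s, γ s)) (hφ' : DifferentiableAt ℝ φ' p)
    (hφφ' : ∀ᶠ q in 𝓝[graph J S] p, φ q = φ' q) :
    surfaceMaterialDeriv J S v φ p = fderiv ℝ φ' p (1, v p) := by
  subst hp
  have hG := hγ.mem_graph hs
  have h1 : HasFDerivWithinAt φ (fderiv ℝ φ' (s, γ s)) (graph J S) (s, γ s) :=
    hφ'.hasFDerivAt.hasFDerivWithinAt.congr_of_eventuallyEq hφφ' (hφφ'.self_of_nhdsWithin hG)
  refine (hγ.hasDerivAt_comp hJ hs h1.differentiableWithinAt).unique ?_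
  refine h1.comp_hasDerivAt s (hγ.hasDerivAt_graph hs) ?_
  filter_upwards [hJ.mem_nhds hs] with r hr using hγ.mem_graph hr

/-- Near a point of the graph, `φ` grows along trajectories at the rate given by its material
derivative, uniformly. -/
theorem exists_abs_sub_materialDeriv_le (hJ : IsOpen J) {t : ℝ} {x₀ : EuclideanSpace ℝ (Fin n)}
    (hp : (t, x₀) ∈ graph J S) (hv : ContinuousWithinAt v (graph J S) (t, x₀))
    (hφ' : ContDiffAt ℝ 1 φ' (t, x₀)) (hφφ' : ∀ᶠ q in 𝓝[graph J S] (t, x₀), φ q = φ' q) {ε : ℝ}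
    (hε : 0 < ε) :
    ∃ r > 0, ∃ δ > 0, ∀ γ, IsSurfaceTrajectory J S v γ → γ t ∈ Metric.ball x₀ r →
      ∀ s ∈ Metric.ball t δ,
      |φ (s, γ s) - φ (t, γ t) - (s - t) * surfaceMaterialDeriv J S v φ (t, γ t)|
        ≤ ε * |s - t| := by
  set ψ := fun p : ℝ × EuclideanSpace ℝ (Fin n) => fderiv ℝ φ' p (1, v p) with hψ
  have hψc : ContinuousWithinAt ψ (graph J S) (t, x₀) :=
    ContinuousWithinAt.clm_apply (hφ'.continuousAt_fderiv one_ne_zero).continuousWithinAt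
      (continuousWithinAt_const.prodMk hv)
  have h1 : ∀ᶠ p in 𝓝[graph J S] (t, x₀), |ψ p - ψ (t, x₀)| < ε / 2 := by
    have := Metric.tendsto_nhds.mp hψc (ε / 2) (by positivity)
    simpa only [Real.dist_eq] using this
  have h2 : ∀ᶠ p in 𝓝[graph J S] (t, x₀), DifferentiableAt ℝ φ' p := by
    refine nhdsWithin_le_nhds ((hφ'.eventually (by simp)).mono fun p hp => ?_)
    exact hp.differentiableAt one_ne_zero
  obtain ⟨R, hR, hball⟩ := Metric.mem_nhdsWithin_iff.mp
    ((h1.and h2).and (eventually_eventually_nhdsWithin.mpr hφφ'))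
  obtain ⟨r, hr, δ, hδ, hδJ, hstay⟩ := exists_trajectory_mem_ball hJ hp hv hR
  refine ⟨r, hr, δ, hδ, fun γ hγ hγt s hs => ?_⟩
  have ht : t ∈ Metric.ball t δ := Metric.mem_ball_self hδ
  have hmem : ∀ u ∈ Metric.ball t δ, (u, γ u) ∈ Metric.ball (t, x₀) R ∩ graph J S := fun u hu =>
    (hstay γ hγ t ht hγt u hu).symm
  have hmat : ∀ u ∈ Metric.ball t δ, surfaceMaterialDeriv J S v φ (u, γ u) = ψ (u, γ u) := by
    intro u hu
    obtain ⟨⟨-, h4⟩, h5⟩ := hball (hmem u hu)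
    exact hγ.surfaceMaterialDeriv_eq hJ (hδJ hu) rfl h4 h5
  have hderiv : ∀ u ∈ Metric.ball t δ,
      HasDerivAt (fun u => φ (u, γ u)) (surfaceMaterialDeriv J S v φ (u, γ u)) u := by
    intro u hu
    obtain ⟨⟨-, h4⟩, h5⟩ := hball (hmem u hu)
    refine hγ.hasDerivAt_comp hJ (hδJ hu) ?_
    exact h4.differentiableWithinAt.congr_of_eventuallyEq h5
      (h5.self_of_nhdsWithin (hmem u hu).2)
  set D := surfaceMaterialDeriv J S v φ (t, γ t) with hD
  have hmv := (convex_ball t δ).norm_image_sub_le_of_norm_hasDerivWithin_le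
    (f := fun u => φ (u, γ u) - u * D)
    (f' := fun u => surfaceMaterialDeriv J S v φ (u, γ u) - 1 * D) (C := ε)
    (fun u hu => ((hderiv u hu).sub ((hasDerivAt_id u).mul_const D)).hasDerivWithinAt)
    (fun u hu => by
      rw [hD, hmat u hu, hmat t ht, one_mul, Real.norm_eq_abs]
      have h5 := (hball (hmem u hu)).1.1
      have h6 := (hball (hmem t ht)).1.1
      have h7 := abs_sub_le (ψ (u, γ u)) (ψ (t, x₀)) (ψ (t, γ t))
      rw [abs_sub_comm (ψ (t, x₀))] at h7
      linarith)
    ht hs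
  have e : φ (s, γ s) - φ (t, γ t) - (s - t) * D
      = (φ (s, γ s) - s * D) - (φ (t, γ t) - t * D) := by ring
  rw [e]
  exact hmv

end Material

/-! ### First order expansion of transported integrals -/

/-- A local bound for a finitely additive set function by a measure gives the same bound on
a compact set. -/
theorem abs_le_of_forall_local_abs_le {X : Type*} [TopologicalSpace X] [MeasurableSpace X]
    [OpensMeasurableSpace X] {K : Set X} (hK : IsCompact K) (hKm : MeasurableSet K)
    {μ : Measure X} (hμ : μ K ≠ ∞) {α : Set X → ℝ} {c : ℝ}
    (hα : ∀ B₁ B₂, B₁ ⊆ K → B₂ ⊆ K → MeasurableSet B₁ → MeasurableSet B₂ → Disjoint B₁ B₂ →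
      α (B₁ ∪ B₂) = α B₁ + α B₂)
    (hloc : ∀ x ∈ K, ∃ U, IsOpen U ∧ x ∈ U ∧ ∀ B ⊆ K ∩ U, MeasurableSet B →
      |α B| ≤ c * μ.real B) : |α K| ≤ c * μ.real K := by
  have hα0 : α ∅ = 0 := by
    have := hα ∅ ∅ (empty_subset _) (empty_subset _) .empty .empty (disjoint_bot_left)
    rw [union_empty] at this
    linarith
  obtain ⟨T, -, hKT, hT⟩ := hK.induction_on
    (p := fun s => ∃ T, MeasurableSet T ∧ s ⊆ T ∧ ∀ B ⊆ K ∩ T, MeasurableSet B →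
      |α B| ≤ c * μ.real B)
    ⟨∅, .empty, subset_rfl, fun B hB _ => by
      rw [inter_empty, subset_empty_iff] at hB
      simp [hB, hα0]⟩
    (fun s t hst ⟨T, hT, htT, h⟩ => ⟨T, hT, hst.trans htT, h⟩)
    (fun s t ⟨T₁, hT₁, hs, h₁⟩ ⟨T₂, hT₂, ht, h₂⟩ =>
      ⟨T₁ ∪ T₂, hT₁.union hT₂, union_subset_union hs ht, fun B hB hBm => by
        have hBK : B ⊆ K := hB.trans inter_subset_left
        have hfin : ∀ B' ⊆ B, μ B' ≠ ∞ := fun B' hB' =>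
          ne_top_of_le_ne_top hμ (measure_mono (hB'.trans hBK))
        have hdisj : Disjoint (B ∩ T₁) (B \ T₁) := disjoint_sdiff_inter.symm
        have e1 := hα (B ∩ T₁) (B \ T₁) (inter_subset_left.trans hBK) (sdiff_subset.trans hBK)
          (hBm.inter hT₁) (hBm.diff hT₁) hdisj
        have e2 : μ.real (B ∩ T₁) + μ.real (B \ T₁) = μ.real B :=
          measureReal_inter_add_sdiff hT₁ (hfin B subset_rfl)
        have b1 := h₁ (B ∩ T₁) (inter_subset_inter_left _ hBK) (hBm.inter hT₁)
        have b2 := h₂ (B \ T₁) (fun x hx => ⟨hBK hx.1, (hB hx.1).2.resolve_left hx.2⟩)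
          (hBm.diff hT₁)
        rw [inter_union_sdiff] at e1
        rw [e1, ← e2, mul_add]
        exact (abs_add_le _ _).trans (add_le_add b1 b2)⟩)
    (fun x hx => by
      obtain ⟨U, hU, hxU, h⟩ := hloc x hx
      exact ⟨U, nhdsWithin_le_nhds (hU.mem_nhds hxU), U, hU.measurableSet, subset_rfl, h⟩)
  exact hT K (subset_inter subset_rfl hKT) hKm

theorem abs_setIntegral_sub_const_mul_le {X : Type*} [MeasurableSpace X] {μ : Measure X}
    {B : Set X} (hμ : μ B ≠ ∞) {g : X → ℝ} {c k : ℝ}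
    (hg : IntegrableOn g B μ) (hk : ∀ x ∈ B, |g x - c| ≤ k) :
    |∫ x in B, g x ∂μ - c * μ.real B| ≤ k * μ.real B := by
  have h1 : ∫ x in B, g x ∂μ - c * μ.real B = ∫ x in B, (g x - c) ∂μ := by
    rw [integral_sub hg (integrableOn_const hμ), setIntegral_const, smul_eq_mul, mul_comm c]
  rw [h1, ← Real.norm_eq_abs]
  exact norm_setIntegral_le_of_norm_le_const hμ.lt_top hk

variable {n : ℕ} {J : Set ℝ} {S : ℝ → Set (EuclideanSpace ℝ (Fin n))}
  {v : ℝ × EuclideanSpace ℝ (Fin n) → EuclideanSpace ℝ (Fin n)}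

theorem tendsto_section_nhdsWithin_graph {t : ℝ} (ht : t ∈ J) (x₀ : EuclideanSpace ℝ (Fin n)) :
    Tendsto (fun x => (t, x)) (𝓝[S t] x₀) (𝓝[graph J S] (t, x₀)) := by
  refine tendsto_nhdsWithin_iff.mpr ⟨?_, ?_⟩
  · exact ((Continuous.prodMk_right t).tendsto x₀).mono_left nhdsWithin_le_nhds
  · filter_upwards [self_mem_nhdsWithin] with x hx using ⟨ht, hx⟩

/-- The flow from time `t` to time `t + h` multiplies the area of small pieces near `x` by
`1 + h div v (t, x)`, up to `ε |h|`, for all small `h`; the size of the pieces depends on `h`. -/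
theorem eventually_exists_abs_area_sub_le (hJ : IsOpen J) (hG : IsHypersurface 1 (graph J S))
    (hv : ContDiffOn ℝ 1 v (graph J S)) {t : ℝ} (ht : t ∈ J) (hSt : IsHypersurface 1 (S t))
    {K : Set (EuclideanSpace ℝ (Fin n))} (hK : IsCompact K) (hKS : K ⊆ S t)
    {Φ : ℝ → EuclideanSpace ℝ (Fin n) → EuclideanSpace ℝ (Fin n)}
    (hΦ : ∀ x ∈ K, IsSurfaceTrajectory J S v (fun s => Φ s x) ∧ Φ t x = x)
    {x₀ : EuclideanSpace ℝ (Fin n)} (hx₀ : x₀ ∈ K) {ε : ℝ} (hε : 0 < ε) :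
    ∀ᶠ z : ℝ × EuclideanSpace ℝ (Fin n) in 𝓝 (0, x₀), z.1 ≠ 0 → z.2 ∈ K →
      ∃ r > 0, ∀ B ⊆ K ∩ Metric.ball z.2 r, μHE[n - 1] (Φ (t + z.1) '' B) ≠ ∞ ∧
        |(μHE[n - 1]).real (Φ (t + z.1) '' B)
            - (1 + z.1 * surfaceDiv (S t) (fun y => v (t, y)) z.2) * (μHE[n - 1]).real B|
          ≤ ε * |z.1| * (μHE[n - 1]).real B := by
  have hp : (t, x₀) ∈ graph J S := ⟨ht, hKS hx₀⟩
  obtain ⟨v', hv', hvv'⟩ := hG.exists_contDiffAt_extension hp hv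
  set L := fun x => (fderiv ℝ v' (t, x)).comp
    (ContinuousLinearMap.inr ℝ ℝ (EuclideanSpace ℝ (Fin n))) with hL
  have hLc : ContinuousAt L x₀ := by
    have h1 : ContinuousAt (fun x => fderiv ℝ v' (t, x)) x₀ :=
      ContinuousAt.comp (f := fun x => (t, x)) (hv'.continuousAt_fderiv one_ne_zero)
        (Continuous.prodMk_right t).continuousAt
    exact h1.clm_comp continuousAt_const
  set Λ := ‖L x₀‖ + 1
  obtain ⟨η, hη, δ₁, hδ₁, hdist⟩ :=
    exists_abs_measure_image_sub_le (E := EuclideanSpace ℝ (Fin n)) (n - 1) Λ hε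
  obtain ⟨r, hr, δ₂, hδ₂, -, hflow⟩ := exists_flow_near_linear hJ hp hv' hvv' hη
  have hLnear : ∀ᶠ x in 𝓝 x₀, ‖L x - L x₀‖ ≤ min (η / 4) 1 := by
    have h1 := Metric.tendsto_nhds.mp hLc.tendsto (min (η / 4) 1) (by positivity)
    filter_upwards [h1] with x hx
    rw [← dist_eq_norm]
    exact hx.le
  have hdiv : ∀ᶠ x in 𝓝 x₀, x ∈ S t → surfaceDiv (S t) (fun y => v (t, y)) x
      = LinearMap.trace ℝ _ (compression (tangentSpace (S t) x) (L x)).toLinearMap := by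
    have h1 : ContDiffAt ℝ 1 (fun y => v' (t, y)) x₀ :=
      ContDiffAt.comp x₀ (f := fun y => (t, y)) hv' (contDiffAt_const.prodMk contDiffAt_id)
    have h2 := eventually_surfaceDiv_eq (S := S t) (u := fun y => v (t, y)) h1
      ((tendsto_section_nhdsWithin_graph ht x₀).eventually hvv')
    have h3 : ∀ᶠ x in 𝓝 x₀, ContDiffAt ℝ 1 v' (t, x) :=
      ((Continuous.prodMk_right t).tendsto x₀).eventually (hv'.eventually (by simp))
    filter_upwards [eventually_nhdsWithin_iff.mp h2, h3] with x hx1 hx2 hxS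
    have h4 : HasFDerivAt (fun y => v' (t, y)) (L x) x :=
      HasFDerivAt.comp x (f := fun y => (t, y)) (hx2.differentiableAt one_ne_zero).hasFDerivAt
        (hasFDerivAt_prodMk_right t x)
    rw [hx1 hxS, h4.fderiv]
  have hh : ∀ᶠ h : ℝ in 𝓝 0, |h| < δ₁ ∧ |h| < δ₂ := by
    filter_upwards [Metric.ball_mem_nhds (0 : ℝ) hδ₁, Metric.ball_mem_nhds (0 : ℝ) hδ₂]
      with h h1 h2
    exact ⟨by simpa using h1, by simpa using h2⟩
  have hball : ∀ᶠ x in 𝓝 x₀, x ∈ Metric.ball x₀ (r / 2) := Metric.ball_mem_nhds x₀ (by positivity)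
  refine (hh.prodMk_nhds ((hLnear.and hdiv).and hball)).mono ?_
  rintro ⟨h, x⟩ ⟨⟨hh1, hh2⟩, ⟨hLx, hdivx⟩, hxball⟩ hh0 hxK
  dsimp only at hh1 hh2 hLx hdivx hxball hh0 hxK ⊢
  have hxS := hKS hxK
  -- the size of the pieces depends on `h`, because their tilt has to be small against `h`
  obtain ⟨r₁, hr₁, htilt⟩ := hSt.exists_ball_norm_sub_projection_le hxS
    (show 0 < η * |h| by positivity)
  have hrank := hSt.finrank_tangentSpace_add_one hxS
  rw [finrank_euclideanSpace_fin] at hrank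
  refine ⟨min (r / 2) r₁, by positivity, fun B hB => ?_⟩
  have hBK : B ⊆ K := hB.trans inter_subset_left
  have hBr : B ⊆ Metric.ball x₀ r := fun y hy => by
    have h1 := Metric.mem_ball.mp (hB hy).2
    have h2 := dist_triangle y x x₀
    have h3 := Metric.mem_ball.mp hxball
    have h4 := min_le_left (r / 2) r₁
    rw [Metric.mem_ball]
    linarith
  have hBfin : μHE[n - 1] B ≠ ∞ := by
    have h1 := hSt.measure_lt_top hK hKS
    rw [finrank_euclideanSpace_fin] at h1
    exact ((measure_mono hBK).trans_lt h1).ne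
  have hLxΛ : ‖L x‖ ≤ Λ := by
    have h1 := norm_sub_norm_le (L x) (L x₀)
    have h2 := hLx.trans (min_le_right _ _)
    linarith
  rw [hdivx hxS]
  refine hdist (tangentSpace (S t) x) (by omega) (L x) hLxΛ h hh1 (Φ (t + h)) B hBfin ?_ ?_
  · intro y hy z hz
    obtain ⟨hty, hty'⟩ := hΦ y (hBK hy)
    obtain ⟨htz, htz'⟩ := hΦ z (hBK hz)
    have h1 := hflow _ hty _ htz (by simpa only [hty'] using hBr hy)
      (by simpa only [htz'] using hBr hz) (t + h) (by simpa using hh2) (L x)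
      (hLx.trans (min_le_left _ _))
    simpa only [hty', htz', add_sub_cancel_left] using h1
  · intro y hy z hz
    have hsub : ∀ w ∈ B, w ∈ S t ∩ Metric.ball x r₁ := fun w hw =>
      ⟨hKS (hBK hw), Metric.ball_subset_ball (min_le_right _ _) (hB hw).2⟩
    exact htilt y (hsub y hy) z (hsub z hz)

/-- The elementary inequalities behind `eventually_exists_abs_integral_sub_le`: `a`, `D`, `w` stand
for the values of `φ`, its material derivative and the divergence at a point, `b` and `f` for the
areas of a small piece and of its image, `I` and `I'` for the integrals over these. -/
theorem abs_sub_le_of_expansion {a D w b f I I' h ε₁ C : ℝ} (hb : 0 ≤ b)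
    (hε₁ : 0 ≤ ε₁) (hC : 1 ≤ C) (ha : |a| ≤ C) (hD : |D| ≤ C) (hw : |w| ≤ C)
    (hh1 : |h| * (C + ε₁) ≤ 1) (hh2 : |h| ≤ 1) (hh3 : |h| * C ^ 2 ≤ ε₁)
    (hfb : |f - (1 + h * w) * b| ≤ ε₁ * |h| * b)
    (hI' : |I' - (a + h * D) * f| ≤ 3 * ε₁ * |h| * f)
    (hI : |I - (a + h * (D + a * w)) * b| ≤ 2 * ε₁ * |h| * b) :
    |I' - I| ≤ (9 + 2 * C) * ε₁ * |h| * b := by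
  have hh0 := abs_nonneg h
  have hf2 : f ≤ 2 * b := by
    have h1 := (abs_le.mp hfb).2
    have h2 : h * w ≤ |h| * C := (le_abs_self _).trans (by rw [abs_mul]; gcongr)
    have h3 : h * w * b ≤ |h| * C * b := by gcongr
    have h4 := mul_le_mul_of_nonneg_right hh1 hb
    linarith
  have haD : |a + h * D| ≤ 2 * C := by
    refine (abs_add_le _ _).trans ?_
    rw [abs_mul]
    have : |h| * |D| ≤ 1 * C := by gcongr
    linarith
  have h1 : |(a + h * D) * (f - (1 + h * w) * b)| ≤ 2 * C * (ε₁ * |h| * b) := by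
    rw [abs_mul]
    gcongr
  have h2 : |h ^ 2 * (D * w) * b| ≤ ε₁ * |h| * b := by
    rw [abs_mul, abs_mul, abs_mul, abs_of_nonneg (sq_nonneg h), abs_of_nonneg hb, ← sq_abs h]
    calc |h| ^ 2 * (|D| * |w|) * b ≤ |h| ^ 2 * (C * C) * b := by gcongr
      _ = (|h| * C ^ 2) * |h| * b := by ring
      _ ≤ ε₁ * |h| * b := by gcongr
  have h3 : 3 * ε₁ * |h| * f ≤ 3 * ε₁ * |h| * (2 * b) := by gcongr
  have e : I' - I = (I' - (a + h * D) * f) + (a + h * D) * (f - (1 + h * w) * b)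
      + h ^ 2 * (D * w) * b - (I - (a + h * (D + a * w)) * b) := by ring
  rw [e]
  have t1 := abs_sub ((I' - (a + h * D) * f) + (a + h * D) * (f - (1 + h * w) * b)
      + h ^ 2 * (D * w) * b) (I - (a + h * (D + a * w)) * b)
  have t2 := abs_add_le ((I' - (a + h * D) * f) + (a + h * D) * (f - (1 + h * w) * b))
    (h ^ 2 * (D * w) * b)
  have t3 := abs_add_le (I' - (a + h * D) * f) ((a + h * D) * (f - (1 + h * w) * b))
  linarith

/-- `eventually_exists_abs_area_sub_le` for integrals: on small pieces `B`, the integral of `φ` over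
the image of `B` is that of `φ + h (Dφ + φ div v)` over `B`, up to `ε |h|` times the area. -/
theorem eventually_exists_abs_integral_sub_le (hJ : IsOpen J) (hG : IsHypersurface 1 (graph J S))
    (hv : ContDiffOn ℝ 1 v (graph J S)) {t : ℝ} (ht : t ∈ J) (hSt : IsHypersurface 1 (S t))
    {φ : ℝ × EuclideanSpace ℝ (Fin n) → ℝ} (hφ : ContDiffOn ℝ 1 φ (graph J S))
    {K : Set (EuclideanSpace ℝ (Fin n))} (hK : IsCompact K) (hKS : K ⊆ S t)
    {Φ : ℝ → EuclideanSpace ℝ (Fin n) → EuclideanSpace ℝ (Fin n)}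
    (hΦ : ∀ x ∈ K, IsSurfaceTrajectory J S v (fun s => Φ s x) ∧ Φ t x = x)
    (hDc : ContinuousOn (fun x => surfaceMaterialDeriv J S v φ (t, x)) K)
    (hwc : ContinuousOn (surfaceDiv (S t) (fun y => v (t, y))) K)
    (hint : ∀ s ∈ J, IntegrableOn (fun x => φ (s, x)) (Φ s '' K) μHE[n - 1])
    (hintD : IntegrableOn (fun x => surfaceMaterialDeriv J S v φ (t, x)
      + φ (t, x) * surfaceDiv (S t) (fun y => v (t, y)) x) K μHE[n - 1])
    {x₀ : EuclideanSpace ℝ (Fin n)} (hx₀ : x₀ ∈ K) {ε : ℝ} (hε : 0 < ε) :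
    ∀ᶠ z : ℝ × EuclideanSpace ℝ (Fin n) in 𝓝 (0, x₀), z.1 ≠ 0 → z.2 ∈ K →
      ∃ r > 0, ∀ B ⊆ K ∩ Metric.ball z.2 r,
        |∫ y in Φ (t + z.1) '' B, φ (t + z.1, y) ∂μHE[n - 1]
          - ∫ y in B, (φ (t, y) + z.1 * (surfaceMaterialDeriv J S v φ (t, y)
              + φ (t, y) * surfaceDiv (S t) (fun y => v (t, y)) y)) ∂μHE[n - 1]|
          ≤ ε * |z.1| * (μHE[n - 1]).real B := by
  have hp : (t, x₀) ∈ graph J S := ⟨ht, hKS hx₀⟩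
  set a := fun x => φ (t, x) with ha
  set D := fun x => surfaceMaterialDeriv J S v φ (t, x) with hD
  set w := surfaceDiv (S t) (fun y => v (t, y)) with hw
  have hac : ContinuousOn a K := hφ.continuousOn.comp
    (Continuous.prodMk_right t).continuousOn fun x hx => ⟨ht, hKS hx⟩
  set C := max (max (|a x₀| + 1) (|D x₀| + 1)) (|w x₀| + 1) with hC
  have hC1 : 1 ≤ C := by
    have := abs_nonneg (w x₀)
    exact le_trans (by linarith) (le_max_right _ _)
  set ε₁ := ε / (9 + 2 * C) with hε₁
  have hε₁0 : 0 < ε₁ := by positivity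
  have hbound : ∀ᶠ x in 𝓝[K] x₀, |a x| ≤ C ∧ |D x| ≤ C ∧ |w x| ≤ C := by
    have h1 := (hac x₀ hx₀).abs.eventually (ge_mem_nhds (lt_add_one _))
    have h2 := (hDc x₀ hx₀).abs.eventually (ge_mem_nhds (lt_add_one _))
    have h3 := (hwc x₀ hx₀).abs.eventually (ge_mem_nhds (lt_add_one _))
    filter_upwards [h1, h2, h3] with x hx1 hx2 hx3
    exact ⟨hx1.trans ((le_max_left _ _).trans (le_max_left _ _)),
      hx2.trans ((le_max_right _ _).trans (le_max_left _ _)), hx3.trans (le_max_right _ _)⟩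
  obtain ⟨φ', hφ', hφφ'⟩ := hG.exists_contDiffAt_extension hp hφ
  obtain ⟨r, hr, δ, hδ, hmat⟩ := exists_abs_sub_materialDeriv_le hJ hp
    (hv.continuousOn _ hp) hφ' hφφ' hε₁0
  set δ' := min δ (min (1 / (C + ε₁)) (min 1 (ε₁ / C ^ 2))) with hδ'
  have hδ'0 : 0 < δ' := by positivity
  have hh : ∀ᶠ h : ℝ in 𝓝 0, |h| < δ' ∧ t + h ∈ J := by
    have h1 : Tendsto (fun h : ℝ => t + h) (𝓝 0) (𝓝 t) := by
      simpa using (continuous_const_add t).tendsto (0 : ℝ)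
    filter_upwards [Metric.ball_mem_nhds (0 : ℝ) hδ'0, h1.eventually (hJ.mem_nhds ht)]
      with h h1 h2
    exact ⟨by simpa using h1, h2⟩
  have hball : ∀ᶠ x in 𝓝 x₀, x ∈ Metric.ball x₀ (r / 2) := Metric.ball_mem_nhds x₀ (by positivity)
  refine ((hh.prodMk_nhds ((eventually_nhdsWithin_iff.mp hbound).and hball)).and
    (eventually_exists_abs_area_sub_le hJ hG hv ht hSt hK hKS hΦ hx₀ hε₁0)).mono ?_
  rintro ⟨h, x⟩ ⟨⟨⟨hhδ, hhJ⟩, hxb, hxball⟩, harea⟩ hh0 hxK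
  dsimp only at hhδ hhJ hxb hxball harea hh0 hxK ⊢
  obtain ⟨hax, hDx, hwx⟩ := hxb hxK
  obtain ⟨r₁, hr₁, harea⟩ := harea hh0 hxK
  simp only [hδ', lt_min_iff] at hhδ
  obtain ⟨hhδ, hh1, hh2, hh3⟩ := hhδ
  rw [lt_div_iff₀ (by positivity)] at hh1 hh3
  have hhpos : 0 < |h| := abs_pos.mpr hh0
  have hosc : ∀ᶠ y in 𝓝[K] x, |a y - a x| ≤ ε₁ * |h| ∧ |D y - D x| ≤ ε₁ ∧
      |(D y + a y * w y) - (D x + a x * w x)| ≤ ε₁ := by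
    have h1 := Metric.tendsto_nhds.mp (hac x hxK).tendsto (ε₁ * |h|) (by positivity)
    have h2 := Metric.tendsto_nhds.mp (hDc x hxK).tendsto ε₁ hε₁0
    have h3 := Metric.tendsto_nhds.mp
      ((hDc x hxK).add ((hac x hxK).mul (hwc x hxK))).tendsto ε₁ hε₁0
    filter_upwards [h1, h2, h3] with y hy1 hy2 hy3
    exact ⟨hy1.le, hy2.le, hy3.le⟩
  obtain ⟨r₂, hr₂, hosc⟩ := Metric.mem_nhdsWithin_iff.mp hosc
  refine ⟨min (r / 2) (min r₁ r₂), by positivity, fun B hB => ?_⟩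
  have hBK : B ⊆ K := hB.trans inter_subset_left
  have hBr : B ⊆ Metric.ball x₀ r := fun y hy => by
    have h1 := Metric.mem_ball.mp (hB hy).2
    have h2 := dist_triangle y x x₀
    have h3 := Metric.mem_ball.mp hxball
    have h4 := min_le_left (r / 2) (min r₁ r₂)
    rw [Metric.mem_ball]
    linarith
  have hBosc : ∀ y ∈ B, _ := fun y hy => hosc ⟨Metric.ball_subset_ball
    ((min_le_right _ _).trans (min_le_right _ _)) (hB hy).2, hBK hy⟩
  obtain ⟨hfin, hareaB⟩ := harea B fun y hy => ⟨hBK hy, Metric.ball_subset_ball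
    ((min_le_right _ _).trans (min_le_left _ _)) (hB hy).2⟩
  have hBfin : μHE[n - 1] B ≠ ∞ := by
    have h1 := hSt.measure_lt_top hK hKS
    rw [finrank_euclideanSpace_fin] at h1
    exact ((measure_mono hBK).trans_lt h1).ne
  have hI' := abs_setIntegral_sub_const_mul_le hfin (c := a x + h * D x) (k := 3 * ε₁ * |h|)
    ((hint _ hhJ).mono_set (image_mono hBK)) (by
      rintro _ ⟨y, hy, rfl⟩
      obtain ⟨hty, hty'⟩ := hΦ y (hBK hy)
      have h1 := hmat _ hty (by simpa only [hty'] using hBr hy) (t + h) (by simpa using hhδ)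
      simp only [hty', add_sub_cancel_left] at h1
      obtain ⟨h2, h3, -⟩ := hBosc y hy
      have h4 : |h * (D y - D x)| ≤ |h| * ε₁ := by
        rw [abs_mul]
        gcongr
      have e : φ (t + h, Φ (t + h) y) - (a x + h * D x)
          = (φ (t + h, Φ (t + h) y) - φ (t, y) - h * surfaceMaterialDeriv J S v φ (t, y))
            + (a y - a x) + h * (D y - D x) := by
        simp only [ha, hD]
        ring
      rw [e]
      refine (abs_add_three _ _ _).trans ?_
      linarith)
  have hint0 : IntegrableOn a B μHE[n - 1] := by
    have h1 : Φ t '' K = K := by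
      rw [image_congr fun x hx => (hΦ x hx).2]
      exact image_id' K
    have h2 := hint t ht
    rw [h1] at h2
    exact h2.mono_set hBK
  have hI := abs_setIntegral_sub_const_mul_le hBfin
    (c := a x + h * (D x + a x * w x)) (k := 2 * ε₁ * |h|)
    (hint0.add ((hintD.mono_set hBK).const_mul h)) (by
      intro y hy
      obtain ⟨h2, -, h3⟩ := hBosc y hy
      have h4 : |h * ((D y + a y * w y) - (D x + a x * w x))| ≤ |h| * ε₁ := by
        rw [abs_mul]
        gcongr
      have e : (a y + h * (D y + a y * w y)) - (a x + h * (D x + a x * w x))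
          = (a y - a x) + h * ((D y + a y * w y) - (D x + a x * w x)) := by ring
      refine (congrArg abs e).trans_le ((abs_add_le _ _).trans ?_)
      linarith)
  have hfinal := abs_sub_le_of_expansion measureReal_nonneg hε₁0.le hC1 hax hDx
    hwx hh1.le hh2.le hh3.le hareaB hI' hI
  have e9 : (9 + 2 * C) * ε₁ = ε := by
    rw [hε₁]
    field_simp
  rw [e9] at hfinal
  exact hfinal

theorem continuousOn_surfaceDiv_section (hG : IsHypersurface 1 (graph J S))
    (hv : ContDiffOn ℝ 1 v (graph J S)) {t : ℝ} (ht : t ∈ J) (hSt : IsHypersurface 1 (S t)) :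
    ContinuousOn (surfaceDiv (S t) (fun y => v (t, y))) (S t) := by
  intro x₀ hx₀
  obtain ⟨v', hv', hvv'⟩ :=
    hG.exists_contDiffAt_extension (p := (t, x₀)) ⟨ht, hx₀⟩ hv
  exact hSt.continuousWithinAt_surfaceDiv hx₀
    (ContDiffAt.comp x₀ (f := fun y => (t, y)) hv' (contDiffAt_const.prodMk contDiffAt_id))
    ((tendsto_section_nhdsWithin_graph ht x₀).eventually hvv')

theorem continuousOn_surfaceMaterialDeriv (hJ : IsOpen J) (hG : IsHypersurface 1 (graph J S))
    (hv : ContDiffOn ℝ 1 v (graph J S)) {t : ℝ} (ht : t ∈ J)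
    {φ : ℝ × EuclideanSpace ℝ (Fin n) → ℝ} (hφ : ContDiffOn ℝ 1 φ (graph J S))
    {K : Set (EuclideanSpace ℝ (Fin n))} (hKS : K ⊆ S t)
    (htraj : ∀ x ∈ K, ∃ γ, IsSurfaceTrajectory J S v γ ∧ γ t = x) :
    ContinuousOn (fun x => surfaceMaterialDeriv J S v φ (t, x)) K := by
  intro x₀ hx₀
  have hp : (t, x₀) ∈ graph J S := ⟨ht, hKS hx₀⟩
  obtain ⟨φ', hφ', hφφ'⟩ := hG.exists_contDiffAt_extension hp hφ
  have htend : Tendsto (fun x => (t, x)) (𝓝[K] x₀) (𝓝[graph J S] (t, x₀)) :=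
    (tendsto_section_nhdsWithin_graph ht x₀).mono_left (nhdsWithin_mono _ hKS)
  have h1 : ContinuousWithinAt
      (fun p : ℝ × EuclideanSpace ℝ (Fin n) => fderiv ℝ φ' p (1, v p)) (graph J S) (t, x₀) :=
    ContinuousWithinAt.clm_apply (hφ'.continuousAt_fderiv one_ne_zero).continuousWithinAt
      (continuousWithinAt_const.prodMk (hv.continuousOn _ hp))
  have h2 : ∀ᶠ p in 𝓝[graph J S] (t, x₀), ContDiffAt ℝ 1 φ' p :=
    nhdsWithin_le_nhds (hφ'.eventually (by simp))
  have h3 : ∀ᶠ x in 𝓝[K] x₀, surfaceMaterialDeriv J S v φ (t, x)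
      = fderiv ℝ φ' (t, x) (1, v (t, x)) := by
    filter_upwards [htend.eventually h2,
      htend.eventually (eventually_eventually_nhdsWithin.mpr hφφ'), self_mem_nhdsWithin]
      with x hx1 hx2 hxK
    obtain ⟨γ, hγ, hγt⟩ := htraj x hxK
    exact hγ.surfaceMaterialDeriv_eq hJ ht (by rw [hγt]) (hx1.differentiableAt one_ne_zero) hx2
  have h4 : ContinuousWithinAt (fun x => fderiv ℝ φ' (t, x) (1, v (t, x))) K x₀ :=
    Tendsto.comp (show Tendsto _ _ _ from h1) htend
  exact h4.congr_of_eventuallyEq h3 (h3.self_of_nhdsWithin hx₀)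

/-- A continuous function on a compact piece of a hypersurface is integrable for the surface
measure, which is finite there though not locally finite in the ambient space. -/
theorem IsHypersurface.integrableOn {T : Set (EuclideanSpace ℝ (Fin n))}
    (hT : IsHypersurface 1 T) {K : Set (EuclideanSpace ℝ (Fin n))} (hK : IsCompact K)
    (hKT : K ⊆ T) {g : EuclideanSpace ℝ (Fin n) → ℝ} (hg : ContinuousOn g K) :
    IntegrableOn g K μHE[n - 1] := by
  have hfin := hT.measure_lt_top hK hKT
  rw [finrank_euclideanSpace_fin] at hfin
  obtain ⟨C, hC⟩ := hK.exists_bound_of_continuousOn hg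
  exact ⟨hg.aestronglyMeasurable hK.measurableSet, .restrict_of_bounded C hfin
    ((ae_restrict_iff' hK.measurableSet).mpr (Eventually.of_forall hC))⟩

/-- The transport theorem for `C¹`-hypersurfaces with a `C¹`-graph. The local expansions hold at
each point of `A t` for small `h`; compactness of `A t` makes `h` uniform, and for each such `h` the
expansions over small pieces add up to one over `A t`. -/
theorem hasDerivAt_integral_comovingArea (hJ : IsOpen J) (hJc : J.OrdConnected)
    (hG : IsHypersurface 1 (graph J S)) (hSs : ∀ s ∈ J, IsHypersurface 1 (S s))
    (hv : ContDiffOn ℝ 1 v (graph J S)) {A : ℝ → Set (EuclideanSpace ℝ (Fin n))}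
    (hA : IsCoMovingAreaFamily J S v A) {φ : ℝ × EuclideanSpace ℝ (Fin n) → ℝ}
    (hφ : ContDiffOn ℝ 1 φ (graph J S)) {t : ℝ} (ht : t ∈ J) :
    IntegrableOn (fun x => φ (t, x)) (A t) μHE[n - 1] ∧
    IntegrableOn (fun x => surfaceMaterialDeriv J S v φ (t, x)
      + φ (t, x) * surfaceDiv (S t) (fun y => v (t, y)) x) (A t) μHE[n - 1] ∧
    HasDerivAt (fun s => ∫ x in A s, φ (s, x) ∂μHE[n - 1])
      (∫ x in A t, (surfaceMaterialDeriv J S v φ (t, x)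
        + φ (t, x) * surfaceDiv (S t) (fun y => v (t, y)) x) ∂μHE[n - 1]) t := by
  have hφs : ∀ s ∈ J, IntegrableOn (fun x => φ (s, x)) (A s) μHE[n - 1] := by
    intro s hs
    obtain ⟨hcomp, hsub, -⟩ := hA.exists_flow hJ hJc hG hv hs
    exact (hSs s hs).integrableOn hcomp hsub (hφ.continuousOn.comp
      (Continuous.prodMk_right s).continuousOn fun x hx => ⟨hs, hsub hx⟩)
  obtain ⟨hcomp, hsub, Φ, hΦ, hΦs⟩ := hA.exists_flow hJ hJc hG hv ht
  have hDc : ContinuousOn (fun x => surfaceMaterialDeriv J S v φ (t, x)) (A t) :=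
    continuousOn_surfaceMaterialDeriv hJ hG hv ht hφ hsub fun x hx => ⟨_, hΦ x hx⟩
  have hwc : ContinuousOn (surfaceDiv (S t) (fun y => v (t, y))) (A t) :=
    (continuousOn_surfaceDiv_section hG hv ht (hSs t ht)).mono hsub
  have hac : ContinuousOn (fun x => φ (t, x)) (A t) := hφ.continuousOn.comp
    (Continuous.prodMk_right t).continuousOn fun x hx => ⟨ht, hsub hx⟩
  have hintD : IntegrableOn (fun x => surfaceMaterialDeriv J S v φ (t, x)
      + φ (t, x) * surfaceDiv (S t) (fun y => v (t, y)) x) (A t) μHE[n - 1] :=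
    (hSs t ht).integrableOn hcomp hsub (hDc.add (hac.mul hwc))
  refine ⟨hφs t ht, hintD, ?_⟩
  have hfin : μHE[n - 1] (A t) ≠ ⊤ := by
    have h1 := (hSs t ht).measure_lt_top hcomp hsub
    rw [finrank_euclideanSpace_fin] at h1
    exact h1.ne
  rw [hasDerivAt_iff_isLittleO_nhds_zero, Asymptotics.isLittleO_iff]
  intro c hc
  set m := (μHE[n - 1] : Measure (EuclideanSpace ℝ (Fin n))).real (A t)
  have hm : 0 ≤ m := measureReal_nonneg
  have hloc := hcomp.eventually_forall_of_forall_eventually (x₀ := (0 : ℝ))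
    (P := fun h x => h ≠ 0 → x ∈ A t → ∃ r > 0,
      ∀ B ⊆ A t ∩ Metric.ball x r,
        |∫ y in Φ (t + h) '' B, φ (t + h, y) ∂μHE[n - 1]
          - ∫ y in B, (φ (t, y) + h * (surfaceMaterialDeriv J S v φ (t, y)
              + φ (t, y) * surfaceDiv (S t) (fun y => v (t, y)) y)) ∂μHE[n - 1]|
          ≤ c / (m + 1) * |h| * (μHE[n - 1]).real B) fun x₀ hx₀ =>
      eventually_exists_abs_integral_sub_le hJ hG hv ht (hSs t ht) hφ hcomp hsub hΦ hDc hwc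
        (fun s hs => by rw [(hΦs s hs).2.2]; exact hφs s hs) hintD hx₀
        (show 0 < c / (m + 1) by positivity)
  have hnear : ∀ᶠ h : ℝ in 𝓝 0, t + h ∈ J := by
    have h1 : Tendsto (fun h : ℝ => t + h) (𝓝 0) (𝓝 t) := by
      simpa using (continuous_const_add t).tendsto (0 : ℝ)
    exact h1.eventually (hJ.mem_nhds ht)
  filter_upwards [hloc, hnear] with h hloc hhJ
  rcases eq_or_ne h 0 with rfl | hh0
  · simp
  -- the set function is the error of the expansion over a piece of `A t`
  obtain ⟨hΦc, hΦi, hΦA⟩ := hΦs (t + h) hhJ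
  have hint1 : IntegrableOn (fun y => φ (t, y) + h * (surfaceMaterialDeriv J S v φ (t, y)
      + φ (t, y) * surfaceDiv (S t) (fun y => v (t, y)) y)) (A t) μHE[n - 1] :=
    (hφs t ht).add (hintD.const_mul h)
  have hsum := abs_le_of_forall_local_abs_le hcomp hcomp.measurableSet hfin
    (α := fun B => ∫ y in Φ (t + h) '' B, φ (t + h, y) ∂μHE[n - 1]
      - ∫ y in B, (φ (t, y) + h * (surfaceMaterialDeriv J S v φ (t, y)
          + φ (t, y) * surfaceDiv (S t) (fun y => v (t, y)) y)) ∂μHE[n - 1])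
    (c := c / (m + 1) * |h|)
    (fun B₁ B₂ hB₁ hB₂ hm₁ hm₂ hdisj => by
      have him : MeasurableSet (Φ (t + h) '' B₂) :=
        hm₂.image_of_continuousOn_injOn (hΦc.mono hB₂) (hΦi.mono hB₂)
      have hsubA : ∀ B ⊆ A t, Φ (t + h) '' B ⊆ A (t + h) := fun B hB =>
        hΦA ▸ image_mono hB
      have hdisj' : Disjoint (Φ (t + h) '' B₁) (Φ (t + h) '' B₂) := by
        rw [disjoint_left]
        rintro _ ⟨x, hx, rfl⟩ ⟨y, hy, hxy⟩
        exact disjoint_left.mp hdisj hx (hΦi (hB₂ hy) (hB₁ hx) hxy ▸ hy)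
      rw [image_union, setIntegral_union hdisj' him
        ((hφs _ hhJ).mono_set (hsubA _ hB₁)) ((hφs _ hhJ).mono_set (hsubA _ hB₂)),
        setIntegral_union hdisj hm₂ (hint1.mono_set hB₁) (hint1.mono_set hB₂)]
      ring)
    (fun x hx => by
      obtain ⟨r, hr, hB⟩ := hloc x hx hh0 hx
      exact ⟨Metric.ball x r, Metric.isOpen_ball, Metric.mem_ball_self hr, fun B hBx _ => hB B hBx⟩)
  simp only [hΦA] at hsum
  rw [integral_add (hφs t ht) (hintD.const_mul h), integral_const_mul] at hsum
  rw [Real.norm_eq_abs, Real.norm_eq_abs, smul_eq_mul, sub_sub]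
  refine hsum.trans ?_
  calc c / (m + 1) * |h| * m ≤ c / (m + 1) * |h| * (m + 1) := by gcongr; linarith
    _ = c * |h| := by field_simp

end MovingSurface

theorem mainTheorem5 (n : ℕ) (J : Set ℝ) (hJopen : IsOpen J) (hJconn : J.OrdConnected)
    (S : ℝ → Set (EuclideanSpace ℝ (Fin n)))
    (ν : ℝ × EuclideanSpace ℝ (Fin n) → ℝ × EuclideanSpace ℝ (Fin n))
    (hS : MovingSurface.IsC12Family J S ν)
    (hclosed : ∀ t ∈ J, IsClosed (S t))
    (v : ℝ × EuclideanSpace ℝ (Fin n) → EuclideanSpace ℝ (Fin n))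
    (hv : ContDiffOn ℝ 1 v (MovingSurface.graph J S))
    (hconsistent : ∀ p ∈ MovingSurface.graph J S,
      inner ℝ (v p) (MovingSurface.surfaceNormal ν p) = MovingSurface.normalSpeed ν p)
    (A : ℝ → Set (EuclideanSpace ℝ (Fin n)))
    (hA : MovingSurface.IsCoMovingAreaFamily J S v A)
    (φ : ℝ × EuclideanSpace ℝ (Fin n) → ℝ)
    (hφ : ContDiffOn ℝ 1 φ (MovingSurface.graph J S)) :
    ∀ t ∈ J,
      IntegrableOn (fun x => φ (t, x)) (A t) (Measure.euclideanHausdorffMeasure (n - 1)) ∧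
      IntegrableOn (fun x => MovingSurface.surfaceMaterialDeriv J S v φ (t, x)
          + φ (t, x) * MovingSurface.surfaceDiv (S t) (fun y => v (t, y)) x)
        (A t) (Measure.euclideanHausdorffMeasure (n - 1)) ∧
      HasDerivAt
        (fun s => ∫ x in A s, φ (s, x) ∂(Measure.euclideanHausdorffMeasure (n - 1)))
        (∫ x in A t, (MovingSurface.surfaceMaterialDeriv J S v φ (t, x)
            + φ (t, x) * MovingSurface.surfaceDiv (S t) (fun y => v (t, y)) x)
          ∂(Measure.euclideanHausdorffMeasure (n - 1))) t := by
  exact fun t ht => MovingSurface.hasDerivAt_integral_comovingArea hJopen hJconn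
    hS.graph_hypersurface (fun s hs => (hS.section_hypersurface s hs).of_le one_le_two) hv hA hφ ht
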